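/- Let $\mathbf E_0,\mathbf B_0:\mathbb R^3\to\mathbb R^3$ be real analytic, divergence-free vector fields, put $\mathbf F_0=\mathbf E_0+i\mathbf B_0$ (the Riemann–Silberstein vector), and write $\mathbf X\cdot\mathbf Y=\sum_k X_kY_k$ for the complex bilinear product on $\mathbb C^3$. Let $J=[0,\infty)$ or $J=\mathbb R$, and let $r$ be an order of differentiability, $1\le r\le\infty$ or $r=\omega$. A solution of Maxwell's equations in free space ($c=1$) on $J$ is a pair of $C^r$ fields $\mathbf E,\mathbf B:J\times\mathbb R^3\to\mathbb R^3$ with $$\nabla\cdot\mathbf E=\nabla\cdot\mathbf B=0,\qquad \partial_t\mathbf E=\nabla\times\mathbf B,\qquad \partial_t\mathbf B=-\nabla\times\mathbf E ;$$ put $\mathbf F=\mathbf E+i\mathbf B$. The field is null at time $t$ if $\mathbf F\cdot\mathbf F=0$ at time $t$ on all of $\mathbb R^3$ (equivalently $\mathbf E\cdot\mathbf B=0$ and $\mathbf E\cdot\mathbf E=\mathbf B\cdot\mathbf B$). 1. For every solution on $J$ with $\mathbf E|_{t=0}=\mathbf E_0$, $\mathbf B|_{t=0}=\mathbf B_0$,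 $$\mathbf F_0\cdot\mathbf F_0=0\ \text{ and }\ \mathbf F_0\cdot(\nabla\times\mathbf F_0)=0\ \text{ on }\mathbb R^3\quad\Longleftrightarrow\quad \mathbf F\cdot\mathbf F=0\ \text{ on } J\times\mathbb R^3 .$$ 2. The data $\mathbf F_0$ give rise to a global null solution, i.e. there is a solution on $J$ with these initial data that is null at all times $t\in J$, if and only if $\mathbf F_0\cdot\mathbf F_0=0$ and $\mathbf F_0\cdot(\nabla\times\mathbf F_0)=0$ on $\mathbb R^3$. 3. Suppose $\mathbf F_0\cdot\mathbf F_0=0$ on $\mathbb R^3$, and let $\mathbf V_0=(\mathbf E_0\times\mathbf B_0)/W_0$, $W_0=\tfrac12(\mathbf E_0^2+\mathbf B_0^2)$, be the normalized Poynting field. At each point the following are equivalent (at points with $W_0=0$, where $\mathbf E_0=\mathbf B_0=0$, all three hold trivially): * the shear-free conditions $\sum_{i,j}(E_0^iE_0^j-B_0^iB_0^j)\,\partial_jV_{0i}=0$ and $\sum_{i,j}(E_0^iB_0^j+E_0^jB_0^i)\,\partial_jV_{0i}=0$; * the conformal-foliation conditions $\mathbf V_0\cdot[(\mathbf E_0\cdot\nabla)\mathbf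 B_0+(\mathbf B_0\cdot\nabla)\mathbf E_0]=0$ and $\mathbf V_0\cdot[(\mathbf E_0\cdot\nabla)\mathbf E_0-(\mathbf B_0\cdot\nabla)\mathbf B_0]=0$; * $\mathbf F_0\cdot(\nabla\times\mathbf F_0)=0$. -/

import Mathlib

open scoped ContDiff

noncomputable section

namespace NullLight

/-- Points of physical space `ℝ³`. -/
abbrev Space : Type := EuclideanSpace ℝ (Fin 3)

/-- The partial derivative `∂ⱼ f` at `x`. -/
def pd {A : Type*} [NormedAddCommGroup A] [NormedSpace ℝ A]
    (j : Fin 3) (f : Space → A) (x : Space) : A :=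
  fderiv ℝ f x (EuclideanSpace.single j (1 : ℝ))

/-- The divergence `∇ · f` of a (real or complex) vector field on `ℝ³`. -/
def div {A : Type*} [NormedAddCommGroup A] [NormedSpace ℝ A]
    (f : Space → Fin 3 → A) (x : Space) : A :=
  ∑ i, pd i (fun y => f y i) x

/-- The curl `∇ × f` of a (real or complex) vector field on `ℝ³`. -/
def curl {A : Type*} [NormedAddCommGroup A] [NormedSpace ℝ A]
    (f : Space → Fin 3 → A) (x : Space) : Fin 3 → A :=
  ![pd 1 (fun y => f y 2) x - pd 2 (fun y => f y 1) x,
    pd 2 (fun y => f y 0) x - pd 0 (fun y => f y 2) x,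
    pd 0 (fun y => f y 1) x - pd 1 (fun y => f y 0) x]

/-- The derivative `((a · ∇) f)(x)` of a vector field along the vector `a`. -/
def along (a : Fin 3 → ℝ) (f : Space → Fin 3 → ℝ) (x : Space) : Fin 3 → ℝ :=
  fun i => ∑ j, a j * pd j (fun y => f y i) x

/-- The Riemann–Silberstein vector `F = E + i B`. -/
def rs (E B : Space → Fin 3 → ℝ) (x : Space) : Fin 3 → ℂ :=
  fun i => (E x i : ℂ) + Complex.I * (B x i : ℂ)

/-- `F · F = 0` at every point; `⬝ᵥ` is complex bilinear, without conjugation. -/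
def IsNull (E B : Space → Fin 3 → ℝ) : Prop :=
  ∀ x, rs E B x ⬝ᵥ rs E B x = 0

/-- Energy density `W = (E² + B²) / 2`. -/
def energy (E B : Space → Fin 3 → ℝ) (x : Space) : ℝ :=
  (E x ⬝ᵥ E x + B x ⬝ᵥ B x) / 2

/-- Normalized Poynting field `V = (E × B) / W` (equal to `0` where `W = 0`). -/
def poynting (E B : Space → Fin 3 → ℝ) (x : Space) : Fin 3 → ℝ :=
  (energy E B x)⁻¹ • crossProduct (E x) (B x)

/-- The shear-free conditions at `x`. Both hold trivially where `E = B = 0`, whatever the value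
of the derivative of `V` there. -/
def ShearFreeAt (E B : Space → Fin 3 → ℝ) (x : Space) : Prop :=
  (∑ i, ∑ j, (E x i * E x j - B x i * B x j) * pd j (fun y => poynting E B y i) x = 0) ∧
  (∑ i, ∑ j, (E x i * B x j + E x j * B x i) * pd j (fun y => poynting E B y i) x = 0)

/-- The conformal-foliation conditions at `x`. -/
def ConformalFoliationAt (E B : Space → Fin 3 → ℝ) (x : Space) : Prop :=
  (poynting E B x ⬝ᵥ (along (E x) B x + along (B x) E x) = 0) ∧
  (poynting E B x ⬝ᵥ (along (E x) E x - along (B x) B x) = 0)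

/-- `(E, B)` is a solution of class `C^r` of Maxwell's equations in free space (`c = 1`) for
times in the interval `J`. At an end point of `J` the time derivative is one-sided. -/
structure IsMaxwellSolution (r : WithTop ℕ∞) (J : Set ℝ)
    (E B : ℝ → Space → Fin 3 → ℝ) : Prop where
  contDiffOn_E : ContDiffOn ℝ r (fun p : ℝ × Space => E p.1 p.2) (J ×ˢ Set.univ)
  contDiffOn_B : ContDiffOn ℝ r (fun p : ℝ × Space => B p.1 p.2) (J ×ˢ Set.univ)
  div_E : ∀ t ∈ J, ∀ x, div (E t) x = 0
  div_B : ∀ t ∈ J, ∀ x, div (B t) x = 0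
  ampere : ∀ t ∈ J, ∀ x, derivWithin (fun s => E s x) J t = curl (B t) x
  faraday : ∀ t ∈ J, ∀ x, derivWithin (fun s => B s x) J t = -curl (E t) x

end NullLight

end

/-!
Existence. For analytic data, the spherical means formula gives an analytic solution `A` of the wave
equation with `A = 0` and `∂ₜA = F₀` at time `0`; averaging against `(1 - |y|²)₊²` and `(1 - |y|²)₊`
over the ball instead of over the sphere makes the analyticity visible. Then `F = ∂ₜA - i ∇ × A`
solves `∂ₜF = -i ∇ × F`, `∇ · F = 0`.

Uniqueness. The energy of a solution in a backward light cone does not increase, because the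
Poynting vector is bounded by the energy density; time reversal handles negative times.

Propagation of nullness. Since `∂ₜ(F · F) = -2i F · (∇ × F)`, the two conditions say exactly that
`N = F · F` and `∂ₜN` vanish at time `0`. The Maxwell equations make `F_k² □N`, for each component
`F_k`, a linear combination of `N` and its first derivatives with analytic coefficients. Where
`F_k ≠ 0` at time `0`, the order of vanishing of `N` in `t` is therefore infinite, and analyticity
gives `N = 0` everywhere. (If `F` vanishes at time `0`, then `F = 0`.)

Pointwise equivalences. A null `F` satisfies `V × F = -i F`, so that `V · F = 0`; differentiating
`V · F = 0` along `F` exchanges derivatives of `V` for derivatives of `F`, and differentiating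
`F · F = 0` along `V` yields the curl.
-/

noncomputable section

namespace NullLight

open MeasureTheory Filter Topology
open scoped ContDiff NNReal ENNReal

section CompactIntegral

variable {E H F : Type*} [NormedAddCommGroup E] [NormedSpace ℝ E]
  [NormedAddCommGroup H] [NormedSpace ℝ H] [NormedAddCommGroup F] [NormedSpace ℝ F]
  {S : Type*} [TopologicalSpace S]

theorem continuous_compContinuousLinearMap_left {n : ℕ}
    (q : ContinuousMultilinearMap ℝ (fun _ : Fin n => H) F) {M : S → E →L[ℝ] H}
    (hM : Continuous M) :
    Continuous fun s => q.compContinuousLinearMap fun _ => M s :=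
  ((ContinuousMultilinearMap.compContinuousLinearMapContinuousMultilinear ℝ
    (fun _ : Fin n => E) (fun _ : Fin n => H) F).cont.comp
      (continuous_pi fun _ => hM)).clm_apply continuous_const

theorem norm_compContinuousLinearMap_le_of_norm_le_one {n : ℕ}
    (q : ContinuousMultilinearMap ℝ (fun _ : Fin n => H) F) {M : E →L[ℝ] H} (hM : ‖M‖ ≤ 1) :
    ‖q.compContinuousLinearMap fun _ => M‖ ≤ ‖q‖ := by
  refine (q.norm_compContinuousLinearMap_le _).trans ?_
  rw [Finset.prod_const]
  exact mul_le_of_le_one_right (norm_nonneg _) (pow_le_one₀ (norm_nonneg _) hM)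

theorem radius_le_radius_of_norm_le {p : FormalMultilinearSeries ℝ H F}
    {q : FormalMultilinearSeries ℝ E F} {C : ℝ} (h : ∀ n, ‖q n‖ ≤ C * ‖p n‖) :
    p.radius ≤ q.radius := by
  refine ENNReal.le_of_forall_nnreal_lt fun ρ hρ => ?_
  obtain ⟨D, -, hD⟩ := p.norm_mul_pow_le_of_lt_radius hρ
  refine q.le_radius_of_bound (|C| * D) fun n => ?_
  calc ‖q n‖ * (ρ : ℝ) ^ n ≤ |C| * ‖p n‖ * (ρ : ℝ) ^ n := by
        gcongr
        exact (h n).trans (mul_le_mul_of_nonneg_right (le_abs_self C) (norm_nonneg _))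
    _ = |C| * (‖p n‖ * (ρ : ℝ) ^ n) := mul_assoc _ _ _
    _ ≤ |C| * D := by gcongr; exact hD n

theorem exists_continuousLinearMap_norm_le_one_apply_eq_sub {K T : Set S} (hK : IsCompact K)
    (hTK : T ⊆ K) {L : S → E →L[ℝ] H} (hL : Continuous L) {e₀ : E} {z₀ : H} {r : ℝ} (hr : 0 < r)
    (hT_near : ∀ s ∈ T, ‖L s e₀ - z₀‖ ≤ r / 4) :
    ∃ (M : S → E × ℝ →L[ℝ] H) (c : ℝ), Continuous M ∧ (∀ s ∈ T, ‖M s‖ ≤ 1) ∧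
      ∀ s e, M s (c • (e - e₀), r / 2) = L s e - z₀ := by
  obtain ⟨C₀, hC₀⟩ := hK.exists_bound_of_continuousOn hL.continuousOn
  set C := |C₀| + 1
  have hC : 0 < C := by positivity
  have hLC : ∀ s ∈ T, ‖L s‖ ≤ C := fun s hs => by
    linarith [hC₀ s (hTK hs), le_abs_self C₀]
  refine ⟨fun s => (2 * C)⁻¹ • (L s).comp (ContinuousLinearMap.fst ℝ E ℝ) +
    (2 / r) • (ContinuousLinearMap.toSpanSingleton ℝ (L s e₀ - z₀)).comp
      (ContinuousLinearMap.snd ℝ E ℝ), 2 * C, ?_, fun s hs => ?_, fun s e => ?_⟩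
  · have hsub : Continuous fun s => L s e₀ - z₀ := by fun_prop
    have hspan := (ContinuousLinearMap.toSpanSingletonCLE (𝕜 := ℝ) (E := H)).continuous.comp hsub
    exact ((hL.clm_comp continuous_const).const_smul (2 * C)⁻¹).add
      ((hspan.clm_comp continuous_const).const_smul (2 / r))
  · refine ContinuousLinearMap.opNorm_le_bound _ zero_le_one fun y => ?_
    calc ‖(2 * C)⁻¹ • L s y.1 + (2 / r) • y.2 • (L s e₀ - z₀)‖
        ≤ (2 * C)⁻¹ * ‖L s y.1‖ + 2 / r * (‖y.2‖ * ‖L s e₀ - z₀‖) := by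
          refine (norm_add_le _ _).trans_eq ?_
          rw [norm_smul_of_nonneg (by positivity), norm_smul_of_nonneg (by positivity), norm_smul]
      _ ≤ (2 * C)⁻¹ * (C * ‖y‖) + 2 / r * (‖y‖ * (r / 4)) := by
          gcongr
          · exact (L s).le_of_opNorm_le_of_le (hLC s hs) (norm_fst_le y)
          · exact norm_snd_le y
          · exact hT_near s hs
      _ = 1 * ‖y‖ := by field_simp; ring
  · have hC' : (2 * C)⁻¹ * (2 * C) = 1 := inv_mul_cancel₀ (by positivity)
    have hr' : 2 / r * (r / 2) = 1 := by field_simp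
    change (2 * C)⁻¹ • L s ((2 * C) • (e - e₀)) + (2 / r) • (r / 2) • (L s e₀ - z₀) = L s e - z₀
    rw [map_smul, smul_smul, smul_smul, hC', hr', map_sub]
    module

variable [TopologicalSpace.MetrizableSpace S]
  [MeasurableSpace S] [BorelSpace S] {μ : Measure S} [IsFiniteMeasureOnCompacts μ]

theorem hasFPowerSeriesOnBall_setIntegral_comp [CompleteSpace F] {f : H → F}
    {p : FormalMultilinearSeries ℝ H F} {z₀ : H} {r : ℝ≥0∞} (hf : HasFPowerSeriesOnBall f p z₀ r)
    {K T : Set S} (hK : IsCompact K) (hT : MeasurableSet T) (hTK : T ⊆ K)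
    {w : S → ℝ} (hw : Continuous w) {M : S → E →L[ℝ] H} (hM : Continuous M)
    (hM_le : ∀ s ∈ T, ‖M s‖ ≤ 1) :
    HasFPowerSeriesOnBall (fun e => ∫ s in T, w s • f (z₀ + M s e) ∂μ)
      (fun n => ∫ s in T, w s • (p n).compContinuousLinearMap (fun _ => M s) ∂μ) 0 r := by
  obtain ⟨W, hW⟩ := hK.exists_bound_of_continuousOn hw.continuousOn
  have hμT : μ T < ⊤ := (measure_mono hTK).trans_lt hK.measure_lt_top
  have hcont : ∀ n, Continuous fun s => w s • (p n).compContinuousLinearMap (fun _ => M s) :=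
    fun n => hw.smul (continuous_compContinuousLinearMap_left (p n) hM)
  have hint : ∀ n, IntegrableOn (fun s => w s • (p n).compContinuousLinearMap (fun _ => M s)) T μ :=
    fun n => ((hcont n).continuousOn.integrableOn_compact hK).mono_set hTK
  have hnorm : ∀ n, ∀ s ∈ T, ‖w s • (p n).compContinuousLinearMap (fun _ => M s)‖ ≤ W * ‖p n‖ :=
    fun n s hs => (norm_smul_le _ _).trans <|
      mul_le_mul (hW s (hTK hs)) (norm_compContinuousLinearMap_le_of_norm_le_one (p n) (hM_le s hs))
        (norm_nonneg _) ((norm_nonneg _).trans (hW s (hTK hs)))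
  refine ⟨?_, hf.r_pos, fun {y} hy => ?_⟩
  · refine hf.r_le.trans (radius_le_radius_of_norm_le (C := W * μ.real T) fun n => ?_)
    rw [mul_right_comm]
    exact norm_setIntegral_le_of_norm_le_const hμT (hnorm n)
  · have hy' : ‖y‖ₑ < r := by simpa using hy
    have happly : ∀ n, (∫ s in T, w s • (p n).compContinuousLinearMap (fun _ => M s) ∂μ)
        (fun _ => y) = ∫ s in T, w s • p n (fun _ => M s y) ∂μ := fun n =>
      ((ContinuousMultilinearMap.apply ℝ (fun _ : Fin n => E) F
        (fun _ => y)).integral_comp_comm (hint n)).symm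
    have hsum : Summable fun n => W * (‖p n‖ * ‖y‖ ^ n) := by
      have := p.summable_norm_mul_pow (r := ‖y‖₊) (hy'.trans_le hf.r_le)
      exact this.mul_left W
    simp only [happly, zero_add]
    refine hasSum_integral_of_dominated_convergence (fun n _ => W * (‖p n‖ * ‖y‖ ^ n))
      (fun n => ?_) (fun n => ?_) (Eventually.of_forall fun _ => hsum)
      (integrableOn_const hμT.ne) ?_
    · exact (((ContinuousMultilinearMap.apply ℝ (fun _ : Fin n => E) F
        (fun _ => y)).integrable_comp (hint n))).aestronglyMeasurable
    · refine (ae_restrict_iff' hT).2 (Eventually.of_forall fun s hs => ?_)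
      calc ‖w s • (p n).compContinuousLinearMap (fun _ => M s) (fun _ => y)‖
          ≤ ‖w s • (p n).compContinuousLinearMap (fun _ => M s)‖ * ‖y‖ ^ n :=
            (w s • (p n).compContinuousLinearMap (fun _ => M s)).le_opNorm_mul_pow_of_le
              (pi_norm_const_le y)
        _ ≤ W * ‖p n‖ * ‖y‖ ^ n := by gcongr; exact hnorm n s hs
        _ = W * (‖p n‖ * ‖y‖ ^ n) := mul_assoc _ _ _
    · refine (ae_restrict_iff' hT).2 (Eventually.of_forall fun s hs => ?_)
      refine (hf.hasSum ?_).const_smul (w s)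
      rw [Metric.mem_eball, edist_zero_right]
      refine lt_of_le_of_lt ?_ hy'
      rw [enorm_le_iff_norm_le]
      simpa using (M s).le_of_opNorm_le (hM_le s hs) y

theorem analyticAt_setIntegral_comp_of_norm_sub_le [CompleteSpace F] {f : H → F}
    {p : FormalMultilinearSeries ℝ H F} {z₀ : H} {r : ℝ} (hr : 0 < r)
    (hf : HasFPowerSeriesOnBall f p z₀ (ENNReal.ofReal r))
    {K T : Set S} (hK : IsCompact K) (hT : MeasurableSet T) (hTK : T ⊆ K)
    {w : S → ℝ} (hw : Continuous w) {L : S → E →L[ℝ] H} (hL : Continuous L) {e₀ : E}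
    (hT_near : ∀ s ∈ T, ‖L s e₀ - z₀‖ ≤ r / 4) :
    AnalyticAt ℝ (fun e => ∫ s in T, w s • f (L s e) ∂μ) e₀ := by
  -- The extra variable makes the affine map `e ↦ L s e - z₀` linear; the scaling gives norm `≤ 1`.
  obtain ⟨M, c, hM, hM_le, hM_eq⟩ :=
    exists_continuousLinearMap_norm_le_one_apply_eq_sub hK hTK hL hr hT_near
  have hball : ((0, r / 2) : E × ℝ) ∈ Metric.eball 0 (ENNReal.ofReal r) := by
    rw [Metric.mem_eball, edist_zero_right, ← ofReal_norm, ENNReal.ofReal_lt_ofReal_iff hr,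
      Prod.norm_mk, norm_zero, Real.norm_of_nonneg (by positivity)]
    exact max_lt hr (half_lt_self hr)
  have hshift : AnalyticAt ℝ (fun e : E => (c • (e - e₀), r / 2)) e₀ := by fun_prop
  have hcomp := AnalyticAt.comp_of_eq ((hasFPowerSeriesOnBall_setIntegral_comp (μ := μ)
    hf hK hT hTK hw hM hM_le).analyticAt_of_mem hball) hshift (by simp)
  simpa only [Function.comp_def, hM_eq, add_sub_cancel] using hcomp

theorem analyticOnNhd_setIntegral_comp [CompleteSpace F] {f : H → F}
    (hf : AnalyticOnNhd ℝ f Set.univ) {K : Set S} (hK : IsCompact K) (hKm : MeasurableSet K)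
    {w : S → ℝ} (hw : Continuous w) {L : S → E →L[ℝ] H} (hL : Continuous L) :
    AnalyticOnNhd ℝ (fun e => ∫ s in K, w s • f (L s e) ∂μ) Set.univ := by
  intro e₀ _
  have hfc : Continuous f := hf.continuous
  have hint : ∀ e, IntegrableOn (fun s => w s • f (L s e)) K μ := fun e =>
    ContinuousOn.integrableOn_compact hK (by fun_prop)
  let P : Set S → Prop := fun U => MeasurableSet U ∧ ∀ T ⊆ K ∩ U, MeasurableSet T →
    AnalyticAt ℝ (fun e => ∫ s in T, w s • f (L s e) ∂μ) e₀
  suffices ∃ U, K ⊆ U ∧ P U by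
    obtain ⟨U, hKU, -, hU⟩ := this
    exact hU K (Set.subset_inter subset_rfl hKU) hKm
  refine hK.induction_on (p := fun V => ∃ U, V ⊆ U ∧ P U) ⟨∅, subset_rfl, .empty, ?_⟩ ?_ ?_
    fun s₀ _ => ?_
  · intro T hT _
    simpa [show T = ∅ by simpa using hT] using analyticAt_const
  · rintro V V' hVV' ⟨U, hVU, hU⟩
    exact ⟨U, hVV'.trans hVU, hU⟩
  · rintro V V' ⟨U, hVU, hUm, hU⟩ ⟨U', hVU', hUm', hU'⟩
    refine ⟨U ∪ U', Set.union_subset_union hVU hVU', hUm.union hUm', fun T hT hTm => ?_⟩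
    have hsplit : ∀ e, ∫ s in T, w s • f (L s e) ∂μ =
        ∫ s in T ∩ U, w s • f (L s e) ∂μ + ∫ s in T \ U, w s • f (L s e) ∂μ := fun e =>
      (integral_inter_add_sdiff hUm ((hint e).mono_set (hT.trans Set.inter_subset_left))).symm
    simp only [hsplit]
    exact (hU _ (fun s hs => ⟨(hT hs.1).1, hs.2⟩) (hTm.inter hUm)).add
      (hU' _ (fun s hs => ⟨(hT hs.1).1, (hT hs.1).2.resolve_left hs.2⟩) (hTm.diff hUm))
  · obtain ⟨p, R, hp⟩ := hf (L s₀ e₀) (Set.mem_univ _)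
    obtain ⟨r, hr, hrR⟩ := ENNReal.lt_iff_exists_nnreal_btwn.1 hp.r_pos
    have hr' : (0 : ℝ) < r := by exact_mod_cast hr
    let U := {s | ‖L s e₀ - L s₀ e₀‖ < r / 4}
    have hU : IsOpen U := isOpen_lt (by fun_prop) continuous_const
    have hs₀U : s₀ ∈ U := by simpa [U] using hr
    refine ⟨U, mem_nhdsWithin_of_mem_nhds (hU.mem_nhds hs₀U), U, subset_rfl, hU.measurableSet,
      fun T hT hTm => ?_⟩
    have hp' := hp.mono (ENNReal.ofReal_pos.2 hr') (by simpa using hrR.le)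
    exact analyticAt_setIntegral_comp_of_norm_sub_le hr' hp' hK hTm
      (hT.trans Set.inter_subset_left) hw hL fun s hs => (hT hs).2.le

theorem hasDerivAt_setIntegral_of_continuousOn {U : Set ℝ} (hU : IsOpen U) {K : Set S}
    (hK : IsCompact K) (hKm : MeasurableSet K) {f f' : ℝ → S → F}
    (hf : ContinuousOn (Function.uncurry f) (U ×ˢ K))
    (hf' : ContinuousOn (Function.uncurry f') (U ×ˢ K))
    (hderiv : ∀ t ∈ U, ∀ s ∈ K, HasDerivAt (f · s) (f' t s) t) {t : ℝ} (ht : t ∈ U) :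
    HasDerivAt (fun t => ∫ s in K, f t s ∂μ) (∫ s in K, f' t s ∂μ) t := by
  obtain ⟨ε, hε, hεU⟩ := Metric.nhds_basis_closedBall.mem_iff.1 (hU.mem_nhds ht)
  obtain ⟨C, hC⟩ := ((isCompact_closedBall t ε).prod hK).exists_bound_of_continuousOn
    (hf'.mono (Set.prod_mono_left hεU))
  have hslice : ∀ {g : ℝ → S → F}, ContinuousOn (Function.uncurry g) (U ×ˢ K) → ∀ τ ∈ U,
      ContinuousOn (g τ) K := fun hg τ hτ =>
    hg.comp (Continuous.prodMk_right τ).continuousOn fun s hs => ⟨hτ, hs⟩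
  refine (hasDerivAt_integral_of_dominated_loc_of_deriv_le (bound := fun _ => C)
    (Metric.closedBall_mem_nhds t hε) ?_ ((hslice hf t ht).integrableOn_compact hK)
    ((hslice hf' t ht).aestronglyMeasurable_of_isCompact hK hKm) ?_
    (integrableOn_const hK.measure_ne_top) ?_).2
  · filter_upwards [hU.mem_nhds ht] with τ hτ
    exact (hslice hf τ hτ).aestronglyMeasurable_of_isCompact hK hKm
  · exact (ae_restrict_iff' hKm).2 (Eventually.of_forall fun s hs τ hτ => hC (τ, s) ⟨hτ, hs⟩)
  · exact (ae_restrict_iff' hKm).2 (Eventually.of_forall fun s hs τ hτ =>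
      hderiv τ (hεU hτ) s hs)

end CompactIntegral

section DirectionalDerivative

variable {E A : Type*} [NormedAddCommGroup E] [NormedSpace ℝ E]
  [NormedAddCommGroup A] [NormedSpace ℝ A]

/-- The derivative of `f` at `x` in the direction `v`, with the point as the last argument so that
iterated derivatives compose as operators. -/
def dirDeriv (v : E) (f : E → A) (x : E) : A := fderiv ℝ f x v

/-- Real analyticity on the whole space. -/
abbrev RealAnalytic (f : E → A) : Prop := AnalyticOnNhd ℝ f Set.univ

theorem RealAnalytic.contDiff [CompleteSpace A] {f : E → A} (hf : RealAnalytic f)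
    {n : WithTop ℕ∞} : ContDiff ℝ n f :=
  contDiff_iff_contDiffAt.2 fun x => (hf x (Set.mem_univ _)).contDiffAt

theorem RealAnalytic.differentiable {f : E → A} (hf : RealAnalytic f) : Differentiable ℝ f :=
  fun x => (hf x (Set.mem_univ _)).differentiableAt

theorem RealAnalytic.dirDeriv [CompleteSpace A] {f : E → A} (hf : RealAnalytic f) (v : E) :
    RealAnalytic (dirDeriv v f) := fun x hx =>
  ((ContinuousLinearMap.apply ℝ A v).analyticAt _).comp (hf.fderiv x hx)

theorem RealAnalytic.pd [CompleteSpace A] {f : Space → A} (hf : RealAnalytic f) (i : Fin 3) :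
    RealAnalytic (pd i f) :=
  hf.dirDeriv _

theorem dirDeriv_eq_of_hasFDerivAt {f : E → A} {f' : E →L[ℝ] A} {x : E}
    (hf : HasFDerivAt f f' x) (v : E) : dirDeriv v f x = f' v := by
  rw [dirDeriv, hf.fderiv]

theorem dirDeriv_comm {f : E → A} (hf : ContDiff ℝ 2 f) (v w : E) :
    dirDeriv v (dirDeriv w f) = dirDeriv w (dirDeriv v f) := by
  funext x
  have hdf : DifferentiableAt ℝ (fderiv ℝ f) x :=
    (hf.fderiv_right (m := 1) (by norm_num)).differentiable one_ne_zero x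
  have hsecond : ∀ a b : E, dirDeriv a (dirDeriv b f) x = fderiv ℝ (fderiv ℝ f) x a b := by
    intro a b
    change fderiv ℝ (fun y => fderiv ℝ f y b) x a = _
    rw [fderiv_clm_apply hdf (differentiableAt_const b)]
    simp
  have hsymm : IsSymmSndFDerivAt ℝ f x := hf.contDiffAt.isSymmSndFDerivAt (by simp)
  rw [hsecond, hsecond, hsymm.eq]

theorem dirDeriv_zero (v : E) : dirDeriv v (fun _ => (0 : A)) = fun _ => 0 := by
  funext x
  simp [dirDeriv]

theorem dirDeriv_add {f g : E → A} (hf : Differentiable ℝ f) (hg : Differentiable ℝ g) (v : E) :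
    dirDeriv v (fun x => f x + g x) = fun x => dirDeriv v f x + dirDeriv v g x := by
  funext x
  simp [dirDeriv, fderiv_fun_add (hf x) (hg x)]

theorem dirDeriv_sub {f g : E → A} (hf : Differentiable ℝ f) (hg : Differentiable ℝ g) (v : E) :
    dirDeriv v (fun x => f x - g x) = fun x => dirDeriv v f x - dirDeriv v g x := by
  funext x
  simp [dirDeriv, fderiv_fun_sub (hf x) (hg x)]

theorem dirDeriv_sum {ι : Type*} {s : Finset ι} {f : ι → E → A}
    (hf : ∀ i ∈ s, Differentiable ℝ (f i)) (v : E) :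
    dirDeriv v (fun x => ∑ i ∈ s, f i x) = fun x => ∑ i ∈ s, dirDeriv v (f i) x := by
  funext x
  simp [dirDeriv, fderiv_fun_sum fun i hi => hf i hi x]

theorem dirDeriv_smul {c : E → ℝ} {f : E → A} (hc : Differentiable ℝ c) (hf : Differentiable ℝ f)
    (v : E) :
    dirDeriv v (fun x => c x • f x) = fun x => c x • dirDeriv v f x + dirDeriv v c x • f x := by
  funext x
  simp [dirDeriv, fderiv_fun_smul (hc x) (hf x)]

theorem dirDeriv_const_smul {𝕜 : Type*} [NormedField 𝕜] [NormedSpace 𝕜 A] [SMulCommClass ℝ 𝕜 A]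
    {f : E → A} (hf : Differentiable ℝ f) (c : 𝕜) (v : E) :
    dirDeriv v (fun x => c • f x) = fun x => c • dirDeriv v f x := by
  funext x
  simp [dirDeriv, fderiv_fun_const_smul (hf x)]

theorem dirDeriv_mul {𝔸 : Type*} [NormedCommRing 𝔸] [NormedAlgebra ℝ 𝔸] {f g : E → 𝔸}
    (hf : Differentiable ℝ f) (hg : Differentiable ℝ g) (v : E) :
    dirDeriv v (fun x => f x * g x) = fun x => f x * dirDeriv v g x + dirDeriv v f x * g x := by
  funext x
  simp [dirDeriv, fderiv_fun_mul (hf x) (hg x), mul_comm (g x)]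

end DirectionalDerivative

section IntegrationByParts

theorem hasDerivAt_max_zero_sq (s : ℝ) : HasDerivAt (fun s : ℝ => max 0 s ^ 2) (2 * max 0 s) s := by
  refine hasDerivAt_of_hasDerivAt_of_ne' (x := 0) (g := fun s => 2 * max 0 s) (fun s hs => ?_)
    (by fun_prop) (by fun_prop) s
  rcases hs.lt_or_gt with hneg | hpos
  · rw [max_eq_left hneg.le, mul_zero]
    refine (hasDerivAt_const s (0 : ℝ)).congr_of_eventuallyEq ?_
    filter_upwards [eventually_lt_nhds hneg] with u hu
    simp [max_eq_left hu.le]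
  · rw [max_eq_right hpos.le]
    have hsq : HasDerivAt (fun u : ℝ => u ^ 2) (2 * s) s := by simpa using hasDerivAt_pow 2 s
    refine hsq.congr_of_eventuallyEq ?_
    filter_upwards [eventually_gt_nhds hpos] with u hu
    simp [max_eq_right hu.le]

theorem contDiff_max_zero_sq : ContDiff ℝ 1 fun s : ℝ => max 0 s ^ 2 := by
  refine contDiff_one_iff_deriv.2 ⟨fun s => (hasDerivAt_max_zero_sq s).differentiableAt, ?_⟩
  rw [funext fun s => (hasDerivAt_max_zero_sq s).deriv]
  fun_prop

/-- The weight `(ρ² - |x|²)₊`, supported in the ball of radius `|ρ|`. Its square is `C¹`. -/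
def bump (ρ : ℝ) (x : Space) : ℝ := max 0 (ρ ^ 2 - ‖x‖ ^ 2)

theorem continuous_uncurry_bump : Continuous fun p : ℝ × Space => bump p.1 p.2 := by
  unfold bump
  fun_prop

theorem continuous_bump (ρ : ℝ) : Continuous (bump ρ) :=
  continuous_uncurry_bump.comp (Continuous.prodMk_right ρ)

theorem bump_nonneg (ρ : ℝ) (x : Space) : 0 ≤ bump ρ x := le_max_left _ _

theorem bump_eq_zero {ρ : ℝ} {x : Space} (h : |ρ| ≤ ‖x‖) : bump ρ x = 0 :=
  max_eq_left (sub_nonpos.2 (sq_le_sq.2 (h.trans (le_abs_self _))))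

theorem norm_sq_mul_bump (ρ : ℝ) (x : Space) :
    ‖x‖ ^ 2 * bump ρ x = ρ ^ 2 * bump ρ x - bump ρ x ^ 2 := by
  unfold bump
  rcases le_total (ρ ^ 2 - ‖x‖ ^ 2) 0 with h | h
  · simp [max_eq_left h]
  · rw [max_eq_right h]; ring

theorem contDiff_bump_sq (ρ : ℝ) : ContDiff ℝ 1 fun x => bump ρ x ^ 2 :=
  contDiff_max_zero_sq.comp (contDiff_const.sub (contDiff_norm_sq ℝ))

theorem hasCompactSupport_bump (ρ : ℝ) : HasCompactSupport (bump ρ) :=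
  HasCompactSupport.intro (isCompact_closedBall 0 |ρ|) fun x hx =>
    bump_eq_zero (by simpa using hx : |ρ| < ‖x‖).le

theorem hasCompactSupport_bump_sq (ρ : ℝ) : HasCompactSupport fun x => bump ρ x ^ 2 := by
  simpa only [pow_two, Pi.mul_def] using (hasCompactSupport_bump ρ).mul_right (f' := bump ρ)

theorem continuous_bump_sq (ρ : ℝ) : Continuous fun x => bump ρ x ^ 2 := (continuous_bump ρ).pow 2

theorem hasDerivAt_bump_sq (ρ : ℝ) (x : Space) :
    HasDerivAt (fun ρ => bump ρ x ^ 2) (4 * ρ * bump ρ x) ρ := by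
  have h := (hasDerivAt_max_zero_sq (ρ ^ 2 - ‖x‖ ^ 2)).comp ρ
    (((hasDerivAt_id ρ).pow 2).sub_const (‖x‖ ^ 2))
  refine h.congr_deriv ?_
  simp only [bump, id_eq, Nat.cast_ofNat, Nat.add_one_sub_one, pow_one, mul_one]
  ring

theorem pd_bump_sq (ρ : ℝ) (i : Fin 3) :
    pd i (fun x => bump ρ x ^ 2) = fun x => -4 * bump ρ x * x i := by
  funext x
  have h := (hasDerivAt_max_zero_sq (ρ ^ 2 - ‖x‖ ^ 2)).comp_hasFDerivAt x
    ((hasStrictFDerivAt_norm_sq x).hasFDerivAt.const_sub (ρ ^ 2))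
  refine (dirDeriv_eq_of_hasFDerivAt h _).trans ?_
  simp only [bump, _root_.smul_apply, _root_.neg_apply, coe_innerSL_apply,
    EuclideanSpace.inner_single_right, Real.ringHom_apply, one_mul, nsmul_eq_mul, Nat.cast_ofNat,
    smul_eq_mul]
  ring

theorem integral_smul_pd_eq_neg {A : Type*} [NormedAddCommGroup A] [NormedSpace ℝ A]
    {P : Space → ℝ} (hP : ContDiff ℝ 1 P) (hPs : HasCompactSupport P) {g : Space → A}
    (hg : ContDiff ℝ 1 g) (i : Fin 3) :
    ∫ x, P x • pd i g x = -∫ x, pd i P x • g x := by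
  have hP' : Continuous (pd i P) := (hP.continuous_fderiv one_ne_zero).clm_apply continuous_const
  have hg' : Continuous (pd i g) := (hg.continuous_fderiv one_ne_zero).clm_apply continuous_const
  exact integral_smul_fderiv_eq_neg_fderiv_smul_of_integrable
    ((hP'.smul hg.continuous).integrable_of_hasCompactSupport (hPs.fderiv_apply ℝ _).smul_right)
    ((hP.continuous.smul hg').integrable_of_hasCompactSupport hPs.smul_right)
    ((hP.continuous.smul hg.continuous).integrable_of_hasCompactSupport hPs.smul_right)
    (fun x _ => hP.differentiable one_ne_zero x) (fun x _ => hg.differentiable one_ne_zero x)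

end IntegrationByParts

section CompactlySupportedWeight

variable {E H A S : Type*} [NormedAddCommGroup E] [NormedSpace ℝ E]
  [NormedAddCommGroup H] [NormedSpace ℝ H] [NormedAddCommGroup A] [NormedSpace ℝ A]
  [CompleteSpace A] [TopologicalSpace S] [TopologicalSpace.MetrizableSpace S]
  [MeasurableSpace S] [BorelSpace S] {μ : Measure S} [IsFiniteMeasureOnCompacts μ]
  {f : H → A} {w : S → ℝ} {L : S → E →L[ℝ] H}

theorem RealAnalytic.integral_smul_comp (hf : RealAnalytic f) (hw : Continuous w)
    (hws : HasCompactSupport w) (hL : Continuous L) :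
    RealAnalytic fun e => ∫ s, w s • f (L s e) ∂μ := by
  have hset : ∀ e, ∫ s in tsupport w, w s • f (L s e) ∂μ = ∫ s, w s • f (L s e) ∂μ := fun e =>
    setIntegral_eq_integral_of_forall_compl_eq_zero fun s hs => by
      rw [image_eq_zero_of_notMem_tsupport hs, zero_smul]
  simpa only [hset] using
    analyticOnNhd_setIntegral_comp (μ := μ) hf hws (isClosed_tsupport w).measurableSet hw hL

theorem dirDeriv_integral_smul_comp (hf : RealAnalytic f) (hw : Continuous w)
    (hws : HasCompactSupport w) (hL : Continuous L) (v e : E) :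
    dirDeriv v (fun e => ∫ s, w s • f (L s e) ∂μ) e =
      ∫ s, w s • dirDeriv (L s v) f (L s e) ∂μ := by
  have hset : ∀ g : S → A, ∫ s in tsupport w, w s • g s ∂μ = ∫ s, w s • g s ∂μ := fun g =>
    setIntegral_eq_integral_of_forall_compl_eq_zero fun s hs => by
      rw [image_eq_zero_of_notMem_tsupport hs, zero_smul]
  have hfc : Continuous f := hf.continuous
  have hf' : Continuous (fderiv ℝ f) := (hf.contDiff (n := 1)).continuous_fderiv one_ne_zero
  have hline : ∀ τ s, HasDerivAt (fun τ : ℝ => w s • f (L s (e + τ • v)))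
      (w s • dirDeriv (L s v) f (L s (e + τ • v))) τ := fun τ s => by
    have hτ : HasDerivAt (fun τ : ℝ => L s (e + τ • v)) (L s v) τ := by
      have hid := ((hasDerivAt_id τ).smul_const v).const_add e
      rw [one_smul] at hid
      exact (L s).hasFDerivAt.comp_hasDerivAt τ hid
    exact ((hf.differentiable _).hasFDerivAt.comp_hasDerivAt τ hτ).const_smul (w s)
  have hderiv := hasDerivAt_setIntegral_of_continuousOn (μ := μ) isOpen_univ hws
    (isClosed_tsupport w).measurableSet (f := fun τ s => w s • f (L s (e + τ • v)))
    (f' := fun τ s => w s • dirDeriv (L s v) f (L s (e + τ • v)))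
    (by fun_prop) (by unfold dirDeriv; fun_prop) (fun τ _ s _ => hline τ s) (Set.mem_univ 0)
  simp only [hset, zero_smul, add_zero] at hderiv
  exact ((hf.integral_smul_comp hw hws hL).differentiable e).hasFDerivAt.hasLineDerivAt v
    |>.unique hderiv

end CompactlySupportedWeight

section WeightedMean

/-- Space-time. -/
abbrev ST : Type := ℝ × Space

/-- The unit vector in the time direction. -/
def eT : ST := (1, 0)

/-- The unit vector in the direction of the `i`-th space coordinate. -/
def eX (i : Fin 3) : ST := (0, EuclideanSpace.single i 1)

variable {A : Type*} [NormedAddCommGroup A] [NormedSpace ℝ A]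

theorem hasDerivAt_time {u : ST → A} (hu : Differentiable ℝ u) (t : ℝ) (x : Space) :
    HasDerivAt (fun s => u (s, x)) (dirDeriv eT u (t, x)) t :=
  (hu (t, x)).hasFDerivAt.comp_hasDerivAt t ((hasDerivAt_id t).prodMk (hasDerivAt_const t x))

theorem pd_slice {u : ST → A} (hu : Differentiable ℝ u) (t : ℝ) (i : Fin 3) (x : Space) :
    pd i (fun y => u (t, y)) x = dirDeriv (eX i) u (t, x) :=
  dirDeriv_eq_of_hasFDerivAt
    ((hu (t, x)).hasFDerivAt.comp x (hasFDerivAt_prodMk_right t x)) _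

theorem fderiv_eq_sum_pd (f : Space → A) (x v : Space) :
    fderiv ℝ f x v = ∑ i, v i • pd i f x := by
  conv_lhs => rw [← (EuclideanSpace.basisFun (Fin 3) ℝ).sum_repr v]
  simp [pd]

/-- The Laplacian in the space variables. -/
def stLap (u : ST → A) (p : ST) : A := ∑ i, dirDeriv (eX i) (dirDeriv (eX i) u) p

/-- The weighted mean of `f` over the points `x + t y`, as a function of `(t, x)`. -/
def weightedMean (w : Space → ℝ) (f : Space → A) (p : ST) : A :=
  ∫ y, w y • f (p.2 + p.1 • y)

theorem weightedMean_const_mul (c : ℝ) (w : Space → ℝ) (f : Space → A) (p : ST) :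
    weightedMean (fun y => c * w y) f p = c • weightedMean w f p := by
  simp only [weightedMean, mul_smul, integral_smul]

theorem integrable_weightedMean {w : Space → ℝ} (hw : Continuous w) (hws : HasCompactSupport w)
    {f : Space → A} (hf : Continuous f) (p : ST) :
    Integrable fun y => w y • f (p.2 + p.1 • y) :=
  Continuous.integrable_of_hasCompactSupport (by fun_prop) hws.smul_right

theorem weightedMean_sum {ι : Type*} {s : Finset ι} {w : Space → ℝ} (hw : Continuous w)
    (hws : HasCompactSupport w) {f : ι → Space → A} (hf : ∀ i ∈ s, Continuous (f i)) (p : ST) :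
    weightedMean w (fun x => ∑ i ∈ s, f i x) p = ∑ i ∈ s, weightedMean w (f i) p := by
  simp only [weightedMean, Finset.smul_sum]
  exact integral_finsetSum _ fun i hi => integrable_weightedMean hw hws (hf i hi) p

theorem mul_weightedMean_pd {P : Space → ℝ} (hP : ContDiff ℝ 1 P) (hPs : HasCompactSupport P)
    {f : Space → A} (hf : ContDiff ℝ 1 f) (i : Fin 3) (p : ST) :
    p.1 • weightedMean P (pd i f) p = -weightedMean (pd i P) f p := by
  have hchain : ∀ y, pd i (fun y => f (p.2 + p.1 • y)) y = p.1 • pd i f (p.2 + p.1 • y) :=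
    fun y => by
      have h := (hf.differentiable one_ne_zero (p.2 + p.1 • y)).hasFDerivAt.comp y
        (((hasFDerivAt_id y).const_smul p.1).const_add p.2)
      exact (dirDeriv_eq_of_hasFDerivAt h _).trans (by simp [pd])
  have hparts := integral_smul_pd_eq_neg hP hPs (g := fun y => f (p.2 + p.1 • y)) (by fun_prop) i
  simp only [hchain] at hparts
  simpa only [weightedMean, ← integral_smul, smul_comm p.1] using hparts

/-- The linear map `(t, x) ↦ x + t y`. -/
def dilation (y : Space) : ST →L[ℝ] Space :=
  ContinuousLinearMap.snd ℝ ℝ Space + (ContinuousLinearMap.fst ℝ ℝ Space).smulRight y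

theorem continuous_dilation : Continuous dilation :=
  continuous_const.add
    (ContinuousLinearMap.smulRightL ℝ ST Space (ContinuousLinearMap.fst ℝ ℝ Space)).continuous

variable [CompleteSpace A] {f : Space → A} {w : Space → ℝ}

theorem RealAnalytic.weightedMean (hf : RealAnalytic f) (hw : Continuous w)
    (hws : HasCompactSupport w) : RealAnalytic (weightedMean w f) :=
  hf.integral_smul_comp hw hws continuous_dilation

theorem dirDeriv_eX_weightedMean (hf : RealAnalytic f) (hw : Continuous w)
    (hws : HasCompactSupport w) (i : Fin 3) :
    dirDeriv (eX i) (weightedMean w f) = weightedMean w (pd i f) := by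
  funext p
  refine (dirDeriv_integral_smul_comp hf hw hws continuous_dilation (eX i) p).trans ?_
  simp [dilation, eX, weightedMean, dirDeriv, pd]

theorem stLap_weightedMean (hf : RealAnalytic f) (hw : Continuous w) (hws : HasCompactSupport w) :
    stLap (weightedMean w f) = fun p => ∑ i, weightedMean w (pd i (pd i f)) p := by
  funext p
  refine Finset.sum_congr rfl fun i _ => ?_
  rw [dirDeriv_eX_weightedMean hf hw hws, dirDeriv_eX_weightedMean (hf.pd i) hw hws]

theorem dirDeriv_eT_weightedMean (hf : RealAnalytic f) (hw : Continuous w)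
    (hws : HasCompactSupport w) (p : ST) :
    dirDeriv eT (weightedMean w f) p = ∑ i, weightedMean (fun y => w y * y i) (pd i f) p := by
  have hint : ∀ i, Integrable fun y : Space => (w y * y i) • pd i f (p.2 + p.1 • y) := fun i =>
    integrable_weightedMean (by fun_prop) hws.mul_right (hf.pd i).continuous p
  refine (dirDeriv_integral_smul_comp hf hw hws continuous_dilation eT p).trans ?_
  simp only [weightedMean]
  rw [← integral_finsetSum _ fun i _ => hint i]
  simp [dilation, eT, dirDeriv, fderiv_eq_sum_pd, Finset.smul_sum, mul_smul]

theorem dirDeriv_eT_weightedMean_bump (hf : RealAnalytic f) (p : ST) :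
    dirDeriv eT (weightedMean (bump 1) f) p =
      (p.1 / 4) • stLap (weightedMean (fun y => bump 1 y ^ 2) f) p := by
  have hparts : ∀ i, weightedMean (fun y => bump 1 y * y i) (pd i f) p =
      (p.1 / 4) • weightedMean (fun y => bump 1 y ^ 2) (pd i (pd i f)) p := fun i => by
    have h := mul_weightedMean_pd (contDiff_bump_sq 1) (hasCompactSupport_bump_sq 1)
      ((hf.pd i).contDiff (n := 1)) i p
    simp only [pd_bump_sq, mul_assoc, weightedMean_const_mul] at h
    rw [div_eq_inv_mul, mul_smul, h]
    module
  rw [dirDeriv_eT_weightedMean hf (continuous_bump 1) (hasCompactSupport_bump 1),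
    stLap_weightedMean hf (continuous_bump_sq 1) (hasCompactSupport_bump_sq 1), Finset.smul_sum]
  exact Finset.sum_congr rfl fun i _ => hparts i

theorem pd_bump_sq_mul_coord (ρ : ℝ) (i : Fin 3) :
    pd i (fun y => bump ρ y ^ 2 * y i) = fun y => bump ρ y ^ 2 - 4 * bump ρ y * y i ^ 2 := by
  funext y
  have hcoord : HasFDerivAt (fun y : Space => y i) (EuclideanSpace.proj i : Space →L[ℝ] ℝ) y :=
    (EuclideanSpace.proj i : Space →L[ℝ] ℝ).hasFDerivAt
  have hbump := ((contDiff_bump_sq ρ).differentiable one_ne_zero y).hasFDerivAt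
  have hpd : fderiv ℝ (fun y => bump ρ y ^ 2) y (EuclideanSpace.single i 1) = -4 * bump ρ y * y i :=
    congrFun (pd_bump_sq ρ i) y
  refine (dirDeriv_eq_of_hasFDerivAt (hbump.mul hcoord) _).trans ?_
  simp only [_root_.add_apply, _root_.smul_apply, PiLp.proj_apply, PiLp.single_eq_same,
    smul_eq_mul, mul_one, hpd]
  ring

theorem mul_dirDeriv_eT_weightedMean_bump_sq (hf : RealAnalytic f) (p : ST) :
    p.1 • dirDeriv eT (weightedMean (fun y => bump 1 y ^ 2) f) p =
      (4 : ℝ) • weightedMean (bump 1) f p - (7 : ℝ) • weightedMean (fun y => bump 1 y ^ 2) f p := by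
  have hfc : Continuous f := hf.continuous
  have hC1 : ∀ i : Fin 3, ContDiff ℝ 1 fun y : Space => bump 1 y ^ 2 * y i := fun i =>
    (contDiff_bump_sq 1).mul (EuclideanSpace.proj i : Space →L[ℝ] ℝ).contDiff
  have hsupp : ∀ i : Fin 3, HasCompactSupport fun y : Space => bump 1 y ^ 2 * y i := fun i =>
    (hasCompactSupport_bump_sq 1).mul_right
  have hint₀ := integrable_weightedMean (continuous_bump_sq 1) (hasCompactSupport_bump_sq 1) hfc p
  have hint₁ := integrable_weightedMean (continuous_bump 1) (hasCompactSupport_bump 1) hfc p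
  have hint₂ : ∀ i : Fin 3, Integrable fun y =>
      (bump 1 y ^ 2 - 4 * bump 1 y * y i ^ 2) • f (p.2 + p.1 • y) := fun i => by
    refine integrable_weightedMean ?_ ?_ hfc p
    · have := continuous_bump 1
      fun_prop
    · rw [← pd_bump_sq_mul_coord]
      exact (hsupp i).fderiv_apply ℝ _
  rw [dirDeriv_eT_weightedMean hf (continuous_bump_sq 1) (hasCompactSupport_bump_sq 1),
    Finset.smul_sum,
    Finset.sum_congr rfl fun i _ => mul_weightedMean_pd (hC1 i) (hsupp i) hf.contDiff i p,
    Finset.sum_neg_distrib]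
  simp only [pd_bump_sq_mul_coord, weightedMean]
  rw [← integral_finsetSum _ fun i _ => hint₂ i, ← integral_neg, ← integral_smul, ← integral_smul,
    ← integral_sub (hint₁.fun_smul (4 : ℝ)) (hint₀.fun_smul (7 : ℝ))]
  refine integral_congr_ae (Eventually.of_forall fun y => ?_)
  have hnorm := norm_sq_mul_bump 1 y
  rw [EuclideanSpace.norm_sq_eq] at hnorm
  simp only [Fin.sum_univ_three, Real.norm_eq_abs, sq_abs, ← add_smul, ← neg_smul, smul_smul,
    ← sub_smul] at hnorm ⊢
  congr 1
  linear_combination 4 * hnorm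

end WeightedMean

section EulerPoissonDarboux

variable {A : Type*} [NormedAddCommGroup A] [NormedSpace ℝ A]

theorem dirDeriv_eT_fst_smul {u : ST → A} (hu : Differentiable ℝ u) :
    dirDeriv eT (fun p => p.1 • u p) = fun p => p.1 • dirDeriv eT u p + u p := by
  have hfst : dirDeriv eT (fun p : ST => p.1) = fun _ => 1 := by
    funext p
    exact dirDeriv_eq_of_hasFDerivAt (ContinuousLinearMap.fst ℝ ℝ Space).hasFDerivAt _
  rw [dirDeriv_smul differentiable_fst hu, hfst]
  simp only [one_smul]

theorem dirDeriv_eX_fst_smul {u : ST → A} (hu : Differentiable ℝ u) (i : Fin 3) :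
    dirDeriv (eX i) (fun p => p.1 • u p) = fun p => p.1 • dirDeriv (eX i) u p := by
  have hfst : dirDeriv (eX i) (fun p : ST => p.1) = fun _ => 0 := by
    funext p
    exact dirDeriv_eq_of_hasFDerivAt (ContinuousLinearMap.fst ℝ ℝ Space).hasFDerivAt _
  rw [dirDeriv_smul differentiable_fst hu, hfst]
  simp only [zero_smul, add_zero]

/-- The Euler–Poisson–Darboux equation `t uₜₜ + a uₜ = t Δu`. -/
def SolvesEPD (a : ℝ) (u : ST → A) : Prop :=
  ∀ p, p.1 • dirDeriv eT (dirDeriv eT u) p + a • dirDeriv eT u p = p.1 • stLap u p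

/-- The operator `u ↦ t uₜ + (a - 1) u`, which takes solutions of the Euler–Poisson–Darboux
equation with parameter `a` to solutions with parameter `a - 2`. -/
def lowerEPD (a : ℝ) (u : ST → A) (p : ST) : A := p.1 • dirDeriv eT u p + (a - 1) • u p

theorem RealAnalytic.fst_smul {u : ST → A} (hu : RealAnalytic u) :
    RealAnalytic fun p => p.1 • u p :=
  fun p hp => analyticAt_fst.smul (hu p hp)

theorem lowerEPD_sum {ι : Type*} {s : Finset ι} {u : ι → ST → A}
    (hu : ∀ i ∈ s, Differentiable ℝ (u i)) (a : ℝ) :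
    lowerEPD a (fun p => ∑ i ∈ s, u i p) = fun p => ∑ i ∈ s, lowerEPD a (u i) p := by
  funext p
  simp only [lowerEPD, dirDeriv_sum hu, Finset.smul_sum, Finset.sum_add_distrib]

variable [CompleteSpace A] {u : ST → A}

theorem RealAnalytic.lowerEPD (hu : RealAnalytic u) (a : ℝ) : RealAnalytic (lowerEPD a u) :=
  (hu.dirDeriv eT).fst_smul.add (analyticOnNhd_const.smul hu)

theorem RealAnalytic.stLap (hu : RealAnalytic u) : RealAnalytic (stLap u) :=
  Finset.analyticOnNhd_fun_sum _ fun i _ => (hu.dirDeriv (eX i)).dirDeriv (eX i)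

theorem dirDeriv_eX_lowerEPD (hu : RealAnalytic u) (a : ℝ) (i : Fin 3) :
    dirDeriv (eX i) (lowerEPD a u) = lowerEPD a (dirDeriv (eX i) u) := by
  have hut := hu.dirDeriv eT
  refine (dirDeriv_add hut.fst_smul.differentiable
    (hu.differentiable.fun_const_smul (a - 1)) (eX i)).trans ?_
  rw [dirDeriv_eX_fst_smul hut.differentiable, dirDeriv_const_smul hu.differentiable,
    dirDeriv_comm hu.contDiff]
  rfl

theorem stLap_lowerEPD (hu : RealAnalytic u) (a : ℝ) :
    stLap (lowerEPD a u) = lowerEPD a (stLap u) := by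
  have hterm : ∀ i, dirDeriv (eX i) (dirDeriv (eX i) (lowerEPD a u)) =
      lowerEPD a (dirDeriv (eX i) (dirDeriv (eX i) u)) := fun i => by
    rw [dirDeriv_eX_lowerEPD hu, dirDeriv_eX_lowerEPD (hu.dirDeriv (eX i))]
  funext p
  simp only [stLap, hterm]
  exact (congrFun (lowerEPD_sum (fun i _ =>
    ((hu.dirDeriv (eX i)).dirDeriv (eX i)).differentiable) a) p).symm

theorem SolvesEPD.dirDeriv_eT_lowerEPD {a : ℝ} (h : SolvesEPD a u) (hu : RealAnalytic u) :
    dirDeriv eT (lowerEPD a u) = fun p => p.1 • stLap u p := by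
  have hut := hu.dirDeriv eT
  refine (dirDeriv_add hut.fst_smul.differentiable
    (hu.differentiable.fun_const_smul (a - 1)) eT).trans (funext fun p => ?_)
  rw [dirDeriv_eT_fst_smul hut.differentiable, dirDeriv_const_smul hu.differentiable, ← h p]
  module

theorem SolvesEPD.lowerEPD {a : ℝ} (h : SolvesEPD a u) (hu : RealAnalytic u) :
    SolvesEPD (a - 2) (lowerEPD a u) := by
  intro p
  rw [stLap_lowerEPD hu, h.dirDeriv_eT_lowerEPD hu, dirDeriv_eT_fst_smul hu.stLap.differentiable,
    NullLight.lowerEPD]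
  module

theorem SolvesEPD.wave_fst_smul (h : SolvesEPD 2 u) (hu : RealAnalytic u) :
    dirDeriv eT (dirDeriv eT fun p => p.1 • u p) = stLap fun p => p.1 • u p := by
  have hut := hu.dirDeriv eT
  have hux := fun i => hu.dirDeriv (eX i)
  funext p
  rw [dirDeriv_eT_fst_smul hu.differentiable,
    dirDeriv_add hut.fst_smul.differentiable hu.differentiable,
    dirDeriv_eT_fst_smul hut.differentiable]
  simp only [stLap, dirDeriv_eX_fst_smul hu.differentiable,
    dirDeriv_eX_fst_smul (hux _).differentiable, ← Finset.smul_sum]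
  rw [← stLap, ← h p]
  module

end EulerPoissonDarboux

section WaveEquation

variable {A : Type*} [NormedAddCommGroup A] [NormedSpace ℝ A]

/-- The mean of `f` over the sphere of radius `|t|` about `x`, as a function of `(t, x)`. It is
obtained from the mean of `f` over balls with weight `(1 - |y|²)₊²`, which is visibly analytic in
`(t, x)`; the factor `105 = 7 · 5 · 3` normalizes the three steps that lower the
Euler–Poisson–Darboux parameter from `8` to `2`. -/
def sphericalMean (f : Space → A) : ST → A :=
  lowerEPD 4 (lowerEPD 6 (lowerEPD 8 (weightedMean (fun y => bump 1 y ^ 2)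
    fun x => (105 * ∫ y, bump 1 y ^ 2 : ℝ)⁻¹ • f x)))

/-- Kirchhoff's formula for the solution `u` of the wave equation `uₜₜ = Δu` with `u = 0` and
`uₜ = f` at time `0`. -/
def waveOfVelocity (f : Space → A) (p : ST) : A := p.1 • sphericalMean f p

theorem waveOfVelocity_zero_left (f : Space → A) (x : Space) : waveOfVelocity f (0, x) = 0 :=
  zero_smul _ _

variable [CompleteSpace A] {f : Space → A}

theorem solvesEPD_weightedMean_bump_sq (hf : RealAnalytic f) :
    SolvesEPD 8 (weightedMean (fun y => bump 1 y ^ 2) f) := by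
  set u := weightedMean (fun y => bump 1 y ^ 2) f with hu_def
  have hu : RealAnalytic u := hf.weightedMean (continuous_bump_sq 1) (hasCompactSupport_bump_sq 1)
  have hv : RealAnalytic (weightedMean (bump 1) f) :=
    hf.weightedMean (continuous_bump 1) (hasCompactSupport_bump 1)
  have hfirst : (fun p : ST => p.1 • dirDeriv eT u p) =
      fun p => (4 : ℝ) • weightedMean (bump 1) f p - (7 : ℝ) • u p :=
    funext (mul_dirDeriv_eT_weightedMean_bump_sq hf)
  have hsecond := congrArg (dirDeriv eT) hfirst
  rw [dirDeriv_eT_fst_smul (hu.dirDeriv eT).differentiable,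
    dirDeriv_sub (hv.differentiable.fun_const_smul (4 : ℝ))
      (hu.differentiable.fun_const_smul (7 : ℝ)),
    dirDeriv_const_smul hv.differentiable, dirDeriv_const_smul hu.differentiable] at hsecond
  intro p
  have hp := congrFun hsecond p
  simp only [dirDeriv_eT_weightedMean_bump hf, ← hu_def] at hp
  rw [← eq_sub_iff_add_eq] at hp
  rw [hp]
  module

theorem integral_bump_sq_pos : 0 < ∫ y, bump 1 y ^ 2 :=
  (continuous_bump_sq 1).integral_pos_of_hasCompactSupport_nonneg_nonzero
    (hasCompactSupport_bump_sq 1) (fun y => sq_nonneg _) (x := 0) (by simp [bump])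

theorem RealAnalytic.sphericalMean (hf : RealAnalytic f) : RealAnalytic (sphericalMean f) :=
  (((RealAnalytic.weightedMean (analyticOnNhd_const.smul hf) (continuous_bump_sq 1)
    (hasCompactSupport_bump_sq 1)).lowerEPD 8).lowerEPD 6).lowerEPD 4

theorem RealAnalytic.waveOfVelocity (hf : RealAnalytic f) : RealAnalytic (waveOfVelocity f) :=
  hf.sphericalMean.fst_smul

theorem solvesEPD_sphericalMean (hf : RealAnalytic f) : SolvesEPD 2 (sphericalMean f) := by
  have hcf : RealAnalytic fun x => (105 * ∫ y, bump 1 y ^ 2 : ℝ)⁻¹ • f x :=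
    analyticOnNhd_const.smul hf
  have hu := hcf.weightedMean (continuous_bump_sq 1) (hasCompactSupport_bump_sq 1)
  have h₆ := (solvesEPD_weightedMean_bump_sq hcf).lowerEPD hu
  rw [show (8 : ℝ) - 2 = 6 by norm_num] at h₆
  have h₄ := h₆.lowerEPD (hu.lowerEPD 8)
  rw [show (6 : ℝ) - 2 = 4 by norm_num] at h₄
  have h₂ := h₄.lowerEPD ((hu.lowerEPD 8).lowerEPD 6)
  rw [show (4 : ℝ) - 2 = 2 by norm_num] at h₂
  exact h₂

theorem sphericalMean_zero_left (f : Space → A) (x : Space) : sphericalMean f (0, x) = f x := by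
  have hpos := integral_bump_sq_pos
  simp only [sphericalMean, lowerEPD, weightedMean, zero_smul, zero_add, add_zero,
    integral_smul_const, smul_smul, integral_mul_const]
  set c := ∫ y, bump 1 y ^ 2
  convert one_smul ℝ (f x) using 2
  field_simp
  norm_num

theorem dirDeriv_eX_sphericalMean (hf : RealAnalytic f) (i : Fin 3) :
    dirDeriv (eX i) (sphericalMean f) = sphericalMean (pd i f) := by
  have hcf : RealAnalytic fun x => (105 * ∫ y, bump 1 y ^ 2 : ℝ)⁻¹ • f x :=
    analyticOnNhd_const.smul hf
  have hu := hcf.weightedMean (continuous_bump_sq 1) (hasCompactSupport_bump_sq 1)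
  have hpd := dirDeriv_const_smul hf.differentiable (105 * ∫ y, bump 1 y ^ 2 : ℝ)⁻¹
    (EuclideanSpace.single i (1 : ℝ))
  simp only [sphericalMean]
  rw [dirDeriv_eX_lowerEPD ((hu.lowerEPD 8).lowerEPD 6), dirDeriv_eX_lowerEPD (hu.lowerEPD 8),
    dirDeriv_eX_lowerEPD hu,
    dirDeriv_eX_weightedMean hcf (continuous_bump_sq 1) (hasCompactSupport_bump_sq 1)]
  exact congrArg (fun g => lowerEPD 4 (lowerEPD 6 (lowerEPD 8 (weightedMean _ g)))) hpd

theorem sphericalMean_sum {ι : Type*} {s : Finset ι} {f : ι → Space → A}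
    (hf : ∀ i ∈ s, RealAnalytic (f i)) :
    sphericalMean (fun x => ∑ i ∈ s, f i x) = fun p => ∑ i ∈ s, sphericalMean (f i) p := by
  have hcf : ∀ i ∈ s, RealAnalytic fun x => (105 * ∫ y, bump 1 y ^ 2 : ℝ)⁻¹ • f i x :=
    fun i hi => analyticOnNhd_const.smul (hf i hi)
  have hu := fun i hi =>
    (hcf i hi).weightedMean (continuous_bump_sq 1) (hasCompactSupport_bump_sq 1)
  simp only [sphericalMean, Finset.smul_sum]
  rw [funext (weightedMean_sum (continuous_bump_sq 1) (hasCompactSupport_bump_sq 1)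
      fun i hi => (hcf i hi).continuous),
    lowerEPD_sum fun i hi => (hu i hi).differentiable,
    lowerEPD_sum fun i hi => ((hu i hi).lowerEPD 8).differentiable,
    lowerEPD_sum fun i hi => (((hu i hi).lowerEPD 8).lowerEPD 6).differentiable]

theorem dirDeriv_eT_waveOfVelocity_zero_left (hf : RealAnalytic f) (x : Space) :
    dirDeriv eT (waveOfVelocity f) (0, x) = f x := by
  refine (congrFun (dirDeriv_eT_fst_smul hf.sphericalMean.differentiable) (0, x)).trans ?_
  simp only [zero_smul, zero_add, sphericalMean_zero_left]

theorem wave_waveOfVelocity (hf : RealAnalytic f) :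
    dirDeriv eT (dirDeriv eT (waveOfVelocity f)) = stLap (waveOfVelocity f) :=
  (solvesEPD_sphericalMean hf).wave_fst_smul hf.sphericalMean

theorem dirDeriv_eX_waveOfVelocity (hf : RealAnalytic f) (i : Fin 3) :
    dirDeriv (eX i) (waveOfVelocity f) = waveOfVelocity (pd i f) := by
  refine (dirDeriv_eX_fst_smul hf.sphericalMean.differentiable i).trans ?_
  rw [dirDeriv_eX_sphericalMean hf]
  rfl

theorem waveOfVelocity_sum {ι : Type*} {s : Finset ι} {f : ι → Space → A}
    (hf : ∀ i ∈ s, RealAnalytic (f i)) :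
    waveOfVelocity (fun x => ∑ i ∈ s, f i x) = fun p => ∑ i ∈ s, waveOfVelocity (f i) p := by
  funext p
  simp only [waveOfVelocity, sphericalMean_sum hf, Finset.smul_sum]

theorem waveOfVelocity_zero : waveOfVelocity (fun _ => (0 : A)) = fun _ => 0 := by
  simpa using waveOfVelocity_sum (s := (∅ : Finset ℕ)) (f := fun _ _ => (0 : A)) (by simp)

end WaveEquation

section SpaceTimeVectorCalculus

variable {A : Type*} [NormedAddCommGroup A] [NormedSpace ℝ A]

/-- The divergence in the space variables of a field on space-time, given by its components. -/
def stDiv (f : Fin 3 → ST → A) (p : ST) : A := ∑ i, dirDeriv (eX i) (f i) p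

/-- The curl in the space variables of a field on space-time, given by its components. The indices
are read modulo `3`. -/
def stCurl (f : Fin 3 → ST → A) (i : Fin 3) (p : ST) : A :=
  dirDeriv (eX (i + 1)) (f (i + 2)) p - dirDeriv (eX (i + 2)) (f (i + 1)) p

theorem curl_apply (f : Space → Fin 3 → A) (x : Space) (i : Fin 3) :
    curl f x i = pd (i + 1) (fun y => f y (i + 2)) x - pd (i + 2) (fun y => f y (i + 1)) x := by
  fin_cases i <;> rfl

theorem curl_slice {f : Fin 3 → ST → A} (hf : ∀ i, Differentiable ℝ (f i)) (t : ℝ) (x : Space) :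
    curl (fun y i => f i (t, y)) x = fun i => stCurl f i (t, x) := by
  funext i
  simp only [curl_apply, pd_slice (hf _), stCurl]

theorem div_slice {f : Fin 3 → ST → A} (hf : ∀ i, Differentiable ℝ (f i)) (t : ℝ) (x : Space) :
    div (fun y i => f i (t, y)) x = stDiv f (t, x) := by
  simp only [div, pd_slice (hf _), stDiv]

variable [CompleteSpace A] {f : Fin 3 → ST → A}

theorem RealAnalytic.stCurl (hf : ∀ i, RealAnalytic (f i)) (i : Fin 3) :
    RealAnalytic (stCurl f i) :=
  ((hf _).dirDeriv _).sub ((hf _).dirDeriv _)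

theorem dirDeriv_stDiv (hf : ∀ i, RealAnalytic (f i)) (v : ST) :
    dirDeriv v (stDiv f) = stDiv fun i => dirDeriv v (f i) := by
  refine (dirDeriv_sum (fun i _ => ((hf i).dirDeriv (eX i)).differentiable) v).trans ?_
  funext p
  exact Finset.sum_congr rfl fun i _ => congrFun (dirDeriv_comm (hf i).contDiff _ _) p

theorem dirDeriv_stCurl (hf : ∀ i, RealAnalytic (f i)) (v : ST) (i : Fin 3) :
    dirDeriv v (stCurl f i) = stCurl (fun j => dirDeriv v (f j)) i := by
  refine (dirDeriv_sub ((hf _).dirDeriv _).differentiable ((hf _).dirDeriv _).differentiable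
    v).trans ?_
  simp only [dirDeriv_comm (hf _).contDiff v]
  rfl

theorem stDiv_stCurl (hf : ∀ i, RealAnalytic (f i)) (p : ST) : stDiv (stCurl f) p = 0 := by
  simp only [stDiv, dirDeriv_stCurl hf, Fin.sum_univ_three, stCurl, Fin.isValue, Fin.reduceAdd]
  rw [dirDeriv_comm (hf 2).contDiff (eX 1), dirDeriv_comm (hf 1).contDiff (eX 2),
    dirDeriv_comm (hf 0).contDiff (eX 2)]
  abel

theorem stCurl_stCurl (hf : ∀ i, RealAnalytic (f i)) (hdiv : stDiv f = fun _ => 0) (i : Fin 3)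
    (p : ST) : stCurl (stCurl f) i p = -stLap (f i) p := by
  have hgrad : ∑ j, dirDeriv (eX i) (dirDeriv (eX j) (f j)) p = 0 := by
    refine (congrFun (dirDeriv_sum
      (fun j _ => ((hf j).dirDeriv (eX j)).differentiable) (eX i)) p).symm.trans ?_
    change dirDeriv (eX i) (stDiv f) p = 0
    rw [hdiv, dirDeriv_zero]
  rw [eq_neg_iff_add_eq_zero, ← hgrad]
  simp only [stCurl, dirDeriv_stCurl hf, stLap, Fin.sum_univ_three]
  fin_cases i <;>
    simp only [Fin.zero_eta, Fin.mk_one, Fin.reduceFinMk, Fin.isValue, Fin.reduceAdd] <;> abel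

end SpaceTimeVectorCalculus

section Existence

/-- A real analytic solution on all of space-time of Maxwell's equations in Riemann–Silberstein
form: `∇ · F = 0` and `∂ₜF = -i ∇ × F`. -/
structure IsAnalyticMaxwell (F : Fin 3 → ST → ℂ) : Prop where
  analytic : ∀ i, RealAnalytic (F i)
  div_eq_zero : ∀ p, stDiv F p = 0
  dirDeriv_eT : ∀ i p, dirDeriv eT (F i) p = -Complex.I * stCurl F i p

/-- The electric field `Re F` of a Riemann–Silberstein vector given by its components on
space-time. -/
def electricField (F : Fin 3 → ST → ℂ) (t : ℝ) (x : Space) (i : Fin 3) : ℝ := (F i (t, x)).re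

/-- The magnetic field `Im F` of a Riemann–Silberstein vector given by its components on
space-time. -/
def magneticField (F : Fin 3 → ST → ℂ) (t : ℝ) (x : Space) (i : Fin 3) : ℝ := (F i (t, x)).im

theorem dirDeriv_re {E : Type*} [NormedAddCommGroup E] [NormedSpace ℝ E] {f : E → ℂ}
    (hf : Differentiable ℝ f) (v : E) :
    dirDeriv v (fun x => (f x).re) = fun x => (dirDeriv v f x).re :=
  funext fun x => dirDeriv_eq_of_hasFDerivAt
    (Complex.reCLM.hasFDerivAt.comp x (hf x).hasFDerivAt) v

theorem dirDeriv_im {E : Type*} [NormedAddCommGroup E] [NormedSpace ℝ E] {f : E → ℂ}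
    (hf : Differentiable ℝ f) (v : E) :
    dirDeriv v (fun x => (f x).im) = fun x => (dirDeriv v f x).im :=
  funext fun x => dirDeriv_eq_of_hasFDerivAt
    (Complex.imCLM.hasFDerivAt.comp x (hf x).hasFDerivAt) v

variable {F : Fin 3 → ST → ℂ}

theorem rs_electricField_magneticField (F : Fin 3 → ST → ℂ) (t : ℝ) :
    rs (electricField F t) (magneticField F t) = fun x i => F i (t, x) := by
  funext x i
  simp only [rs, electricField, magneticField, mul_comm Complex.I, Complex.re_add_im]

theorem IsAnalyticMaxwell.isMaxwellSolution (hF : IsAnalyticMaxwell F) (r : WithTop ℕ∞)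
    {J : Set ℝ} (hJ : UniqueDiffOn ℝ J) :
    IsMaxwellSolution r J (electricField F) (magneticField F) := by
  have hd : ∀ i, Differentiable ℝ (F i) := fun i => (hF.analytic i).differentiable
  have hre : ∀ i, Differentiable ℝ fun p => (F i p).re := fun i =>
    Complex.reCLM.differentiable.comp (hd i)
  have him : ∀ i, Differentiable ℝ fun p => (F i p).im := fun i =>
    Complex.imCLM.differentiable.comp (hd i)
  constructor
  · exact (contDiff_pi.2 fun i => Complex.reCLM.contDiff.comp (hF.analytic i).contDiff).contDiffOn
  · exact (contDiff_pi.2 fun i => Complex.imCLM.contDiff.comp (hF.analytic i).contDiff).contDiffOn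
  · intro t _ x
    have hdiv := congrArg Complex.re (hF.div_eq_zero (t, x))
    refine (div_slice hre t x).trans ?_
    simpa only [stDiv, dirDeriv_re (hd _), Complex.re_sum, Complex.zero_re] using hdiv
  · intro t _ x
    have hdiv := congrArg Complex.im (hF.div_eq_zero (t, x))
    refine (div_slice him t x).trans ?_
    simpa only [stDiv, dirDeriv_im (hd _), Complex.im_sum, Complex.zero_im] using hdiv
  · intro t ht x
    refine HasDerivWithinAt.derivWithin (HasDerivAt.hasDerivWithinAt ?_) (hJ t ht)
    refine hasDerivAt_pi.2 fun i => (hasDerivAt_time (hre i) t x).congr_deriv ?_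
    refine Eq.trans ?_ (congrFun (curl_slice him t x) i).symm
    simp [dirDeriv_re (hd i), hF.dirDeriv_eT, stCurl, dirDeriv_im (hd _)]
  · intro t ht x
    refine HasDerivWithinAt.derivWithin (HasDerivAt.hasDerivWithinAt ?_) (hJ t ht)
    refine hasDerivAt_pi.2 fun i => (hasDerivAt_time (him i) t x).congr_deriv ?_
    refine Eq.trans ?_ (congrArg Neg.neg (congrFun (curl_slice hre t x) i).symm)
    simp [dirDeriv_im (hd i), hF.dirDeriv_eT, stCurl, dirDeriv_re (hd _)]

/-- The solution `∂ₜA - i ∇ × A` of Maxwell's equations with initial value `F₀`, where `A` solves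
the wave equation with `A = 0` and `∂ₜA = F₀` at time `0`. -/
def maxwellEvolution (F₀ : Space → Fin 3 → ℂ) (i : Fin 3) (p : ST) : ℂ :=
  dirDeriv eT (waveOfVelocity fun x => F₀ x i) p -
    Complex.I • stCurl (fun j => waveOfVelocity fun x => F₀ x j) i p

variable {F₀ : Space → Fin 3 → ℂ}

theorem RealAnalytic.apply {E ι A : Type*} [NormedAddCommGroup E] [NormedSpace ℝ E] [Fintype ι]
    [NormedAddCommGroup A] [NormedSpace ℝ A] {f : E → ι → A} (hf : RealAnalytic f) (i : ι) :
    RealAnalytic fun x => f x i := fun x hx =>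
  ((ContinuousLinearMap.proj i : (ι → A) →L[ℝ] A).analyticAt _).comp (hf x hx)

theorem stDiv_waveOfVelocity (hF₀ : RealAnalytic F₀) (hdiv : ∀ x, div F₀ x = 0) :
    stDiv (fun j => waveOfVelocity fun x => F₀ x j) = fun _ => 0 := by
  unfold stDiv
  simp only [dirDeriv_eX_waveOfVelocity (hF₀.apply _)]
  rw [← waveOfVelocity_sum fun i _ => (hF₀.apply i).pd i]
  exact (congrArg waveOfVelocity (funext hdiv)).trans waveOfVelocity_zero

theorem stCurl_sub_smul {f g : Fin 3 → ST → ℂ} (hf : ∀ i, Differentiable ℝ (f i))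
    (hg : ∀ i, Differentiable ℝ (g i)) (c : ℂ) (i : Fin 3) (p : ST) :
    stCurl (fun j p => f j p - c • g j p) i p = stCurl f i p - c • stCurl g i p := by
  simp only [stCurl, dirDeriv_sub (hf _) ((hg _).fun_const_smul c), dirDeriv_const_smul (hg _)]
  module

theorem stDiv_sub_smul {f g : Fin 3 → ST → ℂ} (hf : ∀ i, Differentiable ℝ (f i))
    (hg : ∀ i, Differentiable ℝ (g i)) (c : ℂ) (p : ST) :
    stDiv (fun j p => f j p - c • g j p) p = stDiv f p - c • stDiv g p := by
  simp only [stDiv, dirDeriv_sub (hf _) ((hg _).fun_const_smul c), dirDeriv_const_smul (hg _),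
    Finset.sum_sub_distrib, Finset.smul_sum]

theorem isAnalyticMaxwell_maxwellEvolution (hF₀ : RealAnalytic F₀) (hdiv : ∀ x, div F₀ x = 0) :
    IsAnalyticMaxwell (maxwellEvolution F₀) := by
  set A : Fin 3 → ST → ℂ := fun j => waveOfVelocity fun x => F₀ x j
  have hA : ∀ j, RealAnalytic (A j) := fun j => (hF₀.apply j).waveOfVelocity
  have hAt : ∀ j, RealAnalytic (dirDeriv eT (A j)) := fun j => (hA j).dirDeriv eT
  have hcurl : ∀ j, RealAnalytic (stCurl A j) := RealAnalytic.stCurl hA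
  have hdivA : stDiv A = fun _ => 0 := stDiv_waveOfVelocity hF₀ hdiv
  constructor
  · exact fun i => (hAt i).sub (analyticOnNhd_const.smul (hcurl i))
  · intro p
    have hdivAt : stDiv (fun j => dirDeriv eT (A j)) p = 0 := by
      rw [← dirDeriv_stDiv hA, hdivA, dirDeriv_zero]
    refine (stDiv_sub_smul (fun j => (hAt j).differentiable) (fun j => (hcurl j).differentiable)
      Complex.I p).trans ?_
    rw [hdivAt, stDiv_stCurl hA, smul_zero, sub_zero]
  · intro i p
    have hwave : dirDeriv eT (dirDeriv eT (A i)) p = stLap (A i) p :=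
      congrFun (wave_waveOfVelocity (hF₀.apply i)) p
    have htime : dirDeriv eT (maxwellEvolution F₀ i) p =
        stLap (A i) p - Complex.I • stCurl (fun j => dirDeriv eT (A j)) i p := by
      rw [← hwave, ← dirDeriv_stCurl hA]
      refine (congrFun (dirDeriv_sub (hAt i).differentiable
        ((hcurl i).differentiable.fun_const_smul Complex.I) eT) p).trans ?_
      rw [dirDeriv_const_smul (hcurl i).differentiable]
    have hspace : stCurl (maxwellEvolution F₀) i p =
        stCurl (fun j => dirDeriv eT (A j)) i p + Complex.I • stLap (A i) p := by
      refine (stCurl_sub_smul (fun j => (hAt j).differentiable)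
        (fun j => (hcurl j).differentiable) Complex.I i p).trans ?_
      rw [stCurl_stCurl hA hdivA, smul_neg, sub_neg_eq_add]
    rw [htime, hspace, smul_eq_mul, smul_eq_mul]
    linear_combination stLap (A i) p * Complex.I_mul_I

theorem maxwellEvolution_zero_left (hF₀ : RealAnalytic F₀) (i : Fin 3) (x : Space) :
    maxwellEvolution F₀ i (0, x) = F₀ x i := by
  have hcurl : stCurl (fun j => waveOfVelocity fun x => F₀ x j) i (0, x) = 0 := by
    rw [← congrFun (curl_slice (fun j => (hF₀.apply j).waveOfVelocity.differentiable) 0 x) i]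
    simp [curl_apply, waveOfVelocity_zero_left, pd]
  rw [maxwellEvolution, dirDeriv_eT_waveOfVelocity_zero_left (hF₀.apply i), hcurl, smul_zero,
    sub_zero]

end Existence

section PoyntingTheorem

variable {A : Type*} [NormedAddCommGroup A] [NormedSpace ℝ A] {n : WithTop ℕ∞} {J : Set ℝ}

theorem contDiff_space_slice {u : ST → A} (hu : ContDiffOn ℝ n u (J ×ˢ Set.univ)) {t : ℝ}
    (ht : t ∈ J) : ContDiff ℝ n fun x => u (t, x) :=
  contDiffOn_univ.1 (hu.comp (contDiff_prodMk_right t).contDiffOn fun _ _ => ⟨ht, Set.mem_univ _⟩)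

theorem contDiffOn_time_slice {u : ST → A} (hu : ContDiffOn ℝ n u (J ×ˢ Set.univ)) (x : Space) :
    ContDiffOn ℝ n (fun t => u (t, x)) J :=
  hu.comp (contDiff_prodMk_left x).contDiffOn fun _ ht => ⟨ht, Set.mem_univ _⟩

theorem continuousOn_pd_slice {u : ST → A} (hJ : IsOpen J)
    (hu : ContDiffOn ℝ 1 u (J ×ˢ Set.univ)) (i : Fin 3) :
    ContinuousOn (fun p : ST => pd i (fun y => u (p.1, y)) p.2) (J ×ˢ Set.univ) := by
  have hopen : IsOpen (J ×ˢ (Set.univ : Set Space)) := hJ.prod isOpen_univ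
  have hfderiv : ContinuousOn (fun p => fderiv ℝ u p (eX i)) (J ×ˢ Set.univ) :=
    (hu.continuousOn_fderiv_of_isOpen hopen le_rfl).clm_apply continuousOn_const
  refine hfderiv.congr fun p hp => ?_
  have hd : DifferentiableAt ℝ u p :=
    (hu.contDiffAt (hopen.mem_nhds hp)).differentiableAt one_ne_zero
  exact dirDeriv_eq_of_hasFDerivAt (hd.hasFDerivAt.comp p.2 (hasFDerivAt_prodMk_right p.1 p.2)) _

theorem div_crossProduct {U V : Space → Fin 3 → ℝ} (hU : Differentiable ℝ U)
    (hV : Differentiable ℝ V) (x : Space) :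
    div (fun y => crossProduct (U y) (V y)) x = V x ⬝ᵥ curl U x - U x ⬝ᵥ curl V x := by
  have hU' := differentiable_pi.1 hU
  have hV' := differentiable_pi.1 hV
  have hprod : ∀ j k, Differentiable ℝ fun y => U y j * V y k := fun j k =>
    (hU' j).fun_mul (hV' k)
  have hpd : ∀ i j k l m, pd i (fun y => U y j * V y k - U y l * V y m) x =
      U x j * pd i (V · k) x + pd i (U · j) x * V x k -
        (U x l * pd i (V · m) x + pd i (U · l) x * V x m) := fun i j k l m => by
    refine (congrFun (dirDeriv_sub (hprod j k) (hprod l m) _) x).trans ?_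
    rw [dirDeriv_mul (hU' j) (hV' k), dirDeriv_mul (hU' l) (hV' m)]
    rfl
  simp only [div, Fin.sum_univ_three, cross_apply, Matrix.cons_val, hpd, curl, dotProduct]
  ring

variable {E B : ℝ → Space → Fin 3 → ℝ} {t : ℝ}

theorem IsMaxwellSolution.hasDerivAt_E (h : IsMaxwellSolution 1 J E B) (hJ : J ∈ 𝓝 t)
    (x : Space) : HasDerivAt (fun s => E s x) (curl (B t) x) t := by
  have hd : DifferentiableWithinAt ℝ (fun s => E s x) J t :=
    (contDiffOn_time_slice h.contDiffOn_E x).differentiableOn one_ne_zero t (mem_of_mem_nhds hJ)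
  rw [← h.ampere t (mem_of_mem_nhds hJ) x, derivWithin_of_mem_nhds hJ]
  exact (hd.differentiableAt hJ).hasDerivAt

theorem IsMaxwellSolution.hasDerivAt_B (h : IsMaxwellSolution 1 J E B) (hJ : J ∈ 𝓝 t)
    (x : Space) : HasDerivAt (fun s => B s x) (-curl (E t) x) t := by
  have hd : DifferentiableWithinAt ℝ (fun s => B s x) J t :=
    (contDiffOn_time_slice h.contDiffOn_B x).differentiableOn one_ne_zero t (mem_of_mem_nhds hJ)
  rw [← h.faraday t (mem_of_mem_nhds hJ) x, derivWithin_of_mem_nhds hJ]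
  exact (hd.differentiableAt hJ).hasDerivAt

theorem IsMaxwellSolution.hasDerivAt_energy (h : IsMaxwellSolution 1 J E B) (hJ : J ∈ 𝓝 t)
    (x : Space) : HasDerivAt (fun s => energy (E s) (B s) x)
      (-div (fun y => crossProduct (E t y) (B t y)) x) t := by
  have hE := hasDerivAt_pi.1 (h.hasDerivAt_E hJ x)
  have hB := hasDerivAt_pi.1 (h.hasDerivAt_B hJ x)
  have ht := mem_of_mem_nhds hJ
  rw [div_crossProduct ((contDiff_space_slice h.contDiffOn_E ht).differentiable one_ne_zero)
    ((contDiff_space_slice h.contDiffOn_B ht).differentiable one_ne_zero)]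
  refine (((HasDerivAt.fun_sum fun i _ => (hE i).mul (hE i)).add
    (HasDerivAt.fun_sum fun i _ => (hB i).mul (hB i))).div_const 2).congr_deriv ?_
  simp only [dotProduct, Fin.sum_univ_three, Pi.neg_apply]
  ring

theorem energy_nonneg (U V : Space → Fin 3 → ℝ) (x : Space) : 0 ≤ energy U V x := by
  have hU : 0 ≤ U x ⬝ᵥ U x := dotProduct_star_self_nonneg (U x)
  have hV : 0 ≤ V x ⬝ᵥ V x := dotProduct_star_self_nonneg (V x)
  unfold energy
  positivity

theorem energy_eq_zero_iff {U V : Space → Fin 3 → ℝ} {x : Space} :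
    energy U V x = 0 ↔ U x = 0 ∧ V x = 0 := by
  have hU : 0 ≤ U x ⬝ᵥ U x := dotProduct_star_self_nonneg (U x)
  have hV : 0 ≤ V x ⬝ᵥ V x := dotProduct_star_self_nonneg (V x)
  rw [energy, div_eq_zero_iff, or_iff_left two_ne_zero, add_eq_zero_iff_of_nonneg hU hV,
    dotProduct_self_eq_zero, dotProduct_self_eq_zero]

theorem abs_dotProduct_crossProduct_le_norm_mul_energy (U V : Space → Fin 3 → ℝ) (x y : Space) :
    |y ⬝ᵥ crossProduct (U x) (V x)| ≤ ‖y‖ * energy U V x := by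
  have hcauchy : (y ⬝ᵥ crossProduct (U x) (V x)) ^ 2 ≤
      ‖y‖ ^ 2 * (crossProduct (U x) (V x) ⬝ᵥ crossProduct (U x) (V x)) := by
    have h := Finset.sum_mul_sq_le_sq_mul_sq Finset.univ y (crossProduct (U x) (V x))
    simpa only [dotProduct, EuclideanSpace.norm_sq_eq, Real.norm_eq_abs, sq_abs, ← pow_two] using h
  have hlagrange : crossProduct (U x) (V x) ⬝ᵥ crossProduct (U x) (V x) ≤ energy U V x ^ 2 := by
    rw [cross_dot_cross, dotProduct_comm (V x) (U x), energy]
    nlinarith [sq_nonneg (U x ⬝ᵥ V x), sq_nonneg (U x ⬝ᵥ U x - V x ⬝ᵥ V x)]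
  refine abs_le_of_sq_le_sq (hcauchy.trans ?_) (mul_nonneg (norm_nonneg _) (energy_nonneg U V x))
  rw [mul_pow]
  gcongr

end PoyntingTheorem

section LightConeEnergy

theorem integral_mul_div_eq_neg {P : Space → ℝ} (hP : ContDiff ℝ 1 P) (hPs : HasCompactSupport P)
    {V : Space → Fin 3 → ℝ} (hV : ContDiff ℝ 1 V) :
    ∫ x, P x * div V x = -∫ x, (fun i => pd i P x) ⬝ᵥ V x := by
  have hV' := contDiff_pi.1 hV
  have hPc := hP.continuous
  have hPpd : ∀ i, Continuous (pd i P) := fun i =>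
    (hP.continuous_fderiv one_ne_zero).clm_apply continuous_const
  have hVpd : ∀ i, Continuous (pd i fun x => V x i) := fun i =>
    ((hV' i).continuous_fderiv one_ne_zero).clm_apply continuous_const
  have hdiv : ∀ i, Integrable fun x => P x * pd i (V · i) x := fun i =>
    (hPc.mul (hVpd i)).integrable_of_hasCompactSupport hPs.mul_right
  have hgrad : ∀ i, Integrable fun x => pd i P x * V x i := fun i =>
    ((hPpd i).mul (hV' i).continuous).integrable_of_hasCompactSupport
      (hPs.fderiv_apply ℝ _).mul_right
  simp only [div, dotProduct, Finset.mul_sum]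
  rw [integral_finsetSum _ fun i _ => hdiv i, integral_finsetSum _ fun i _ => hgrad i,
    ← Finset.sum_neg_distrib]
  exact Finset.sum_congr rfl fun i _ => integral_smul_pd_eq_neg hP hPs (hV' i) i

/-- The energy inside the backward light cone with apex `(R, 0)`, at time `t`, with a weight that
vanishes on the boundary of the cone. -/
def coneEnergy (R : ℝ) (E B : ℝ → Space → Fin 3 → ℝ) (t : ℝ) : ℝ :=
  ∫ x, bump (R - t) x ^ 2 * energy (E t) (B t) x

variable {E B : ℝ → Space → Fin 3 → ℝ} {R t : ℝ}

theorem bump_sub_eq_zero (ht : t ∈ Set.Icc 0 R) {x : Space}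
    (hx : x ∉ Metric.closedBall (0 : Space) R) : bump (R - t) x = 0 := by
  have hxR : R < ‖x‖ := by simpa using hx
  refine bump_eq_zero ?_
  rw [abs_of_nonneg (sub_nonneg.2 ht.2)]
  linarith [ht.1]

theorem continuousOn_uncurry_energy {J : Set ℝ} {r : WithTop ℕ∞} (h : IsMaxwellSolution r J E B) :
    ContinuousOn (fun p : ST => energy (E p.1) (B p.1) p.2) (J ×ˢ Set.univ) := by
  have hE := continuousOn_pi.1 h.contDiffOn_E.continuousOn
  have hB := continuousOn_pi.1 h.contDiffOn_B.continuousOn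
  unfold energy dotProduct
  fun_prop

theorem continuous_bump_sub (R : ℝ) : Continuous fun p : ST => bump (R - p.1) p.2 :=
  continuous_uncurry_bump.comp (by fun_prop : Continuous fun p : ST => (R - p.1, p.2))

theorem continuousOn_coneEnergy (h : IsMaxwellSolution 1 (Set.Ici 0) E B) :
    ContinuousOn (coneEnergy R E B) (Set.Icc 0 R) := by
  refine continuousOn_integral_of_compact_support (isCompact_closedBall (0 : Space) R) ?_
    fun t x ht hx => by rw [bump_sub_eq_zero ht hx, zero_pow two_ne_zero, zero_mul]
  exact ((continuous_bump_sub R).pow 2).continuousOn.mul ((continuousOn_uncurry_energy h).mono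
    (Set.prod_mono_left Set.Icc_subset_Ici_self))

theorem continuousOn_uncurry_div_crossProduct {J : Set ℝ} (hJ : IsOpen J)
    (h : IsMaxwellSolution 1 J E B) :
    ContinuousOn (fun p : ST => div (fun y => crossProduct (E p.1 y) (B p.1 y)) p.2)
      (J ×ˢ Set.univ) := by
  have hE := contDiffOn_pi.1 h.contDiffOn_E
  have hB := contDiffOn_pi.1 h.contDiffOn_B
  have hcross : ∀ i, ContDiffOn ℝ 1 (fun p : ST => crossProduct (E p.1 p.2) (B p.1 p.2) i)
      (J ×ˢ Set.univ) := by
    intro i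
    fin_cases i <;> exact ((hE _).mul (hB _)).sub ((hE _).mul (hB _))
  exact continuousOn_finsetSum _ fun i _ => continuousOn_pd_slice hJ (hcross i) i

theorem hasDerivAt_coneEnergy (h : IsMaxwellSolution 1 (Set.Ioo 0 R) E B)
    (ht : t ∈ Set.Ioo 0 R) :
    HasDerivAt (coneEnergy R E B) (∫ x, (4 * (t - R) * bump (R - t) x * energy (E t) (B t) x -
      bump (R - t) x ^ 2 * div (fun y => crossProduct (E t y) (B t y)) x)) t := by
  have hset : ∀ s ∈ Set.Ioo 0 R, ∫ x in Metric.closedBall 0 R,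
      bump (R - s) x ^ 2 * energy (E s) (B s) x = coneEnergy R E B s := fun s hs =>
    setIntegral_eq_integral_of_forall_compl_eq_zero fun x hx => by
      rw [bump_sub_eq_zero (Set.Ioo_subset_Icc_self hs) hx, zero_pow two_ne_zero, zero_mul]
  have hbump := continuous_bump_sub R
  have henergy := continuousOn_uncurry_energy h
  have hflux := continuousOn_uncurry_div_crossProduct isOpen_Ioo h
  have hderiv := hasDerivAt_setIntegral_of_continuousOn (μ := volume) isOpen_Ioo
    (isCompact_closedBall (0 : Space) R) Metric.isClosed_closedBall.measurableSet
    (f := fun s x => bump (R - s) x ^ 2 * energy (E s) (B s) x)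
    (f' := fun s x => 4 * (s - R) * bump (R - s) x * energy (E s) (B s) x -
      bump (R - s) x ^ 2 * div (fun y => crossProduct (E s y) (B s y)) x)
    ?_ ?_ (fun s hs x _ => ?_) ht
  · rw [setIntegral_eq_integral_of_forall_compl_eq_zero fun x hx => by
      rw [bump_sub_eq_zero (Set.Ioo_subset_Icc_self ht) hx]; ring] at hderiv
    exact hderiv.congr_of_eventuallyEq
      (eventually_of_mem (Ioo_mem_nhds ht.1 ht.2) fun s hs => (hset s hs).symm)
  · exact ((hbump.pow 2).continuousOn.mul henergy).mono (Set.prod_mono_right (Set.subset_univ _))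
  · have hweight : Continuous fun p : ST => 4 * (p.1 - R) * bump (R - p.1) p.2 := by fun_prop
    exact ((hweight.continuousOn.mul henergy).sub ((hbump.pow 2).continuousOn.mul hflux)).mono
      (Set.prod_mono_right (Set.subset_univ _))
  · have hweight : HasDerivAt (fun s => bump (R - s) x ^ 2) (4 * (s - R) * bump (R - s) x) s :=
      ((hasDerivAt_bump_sq (R - s) x).comp s ((hasDerivAt_id s).const_sub R)).congr_deriv (by ring)
    refine (hweight.mul (h.hasDerivAt_energy (Ioo_mem_nhds hs.1 hs.2) x)).congr_deriv ?_
    ring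

theorem energy_add_flux_nonpos (ht : t ≤ R) (U V : Space → Fin 3 → ℝ) (x : Space) :
    4 * (t - R) * bump (R - t) x * energy U V x +
      (fun i => pd i (fun y => bump (R - t) y ^ 2) x) ⬝ᵥ crossProduct (U x) (V x) ≤ 0 := by
  have hgrad : (fun i => pd i (fun y => bump (R - t) y ^ 2) x) = (-4 * bump (R - t) x) • ⇑x := by
    funext i
    rw [pd_bump_sq, Pi.smul_apply, smul_eq_mul]
  have hcone : bump (R - t) x * ‖x‖ ≤ bump (R - t) x * (R - t) := by
    rcases le_total (R - t) ‖x‖ with hx | hx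
    · rw [bump_eq_zero ((abs_of_nonneg (sub_nonneg.2 ht)).trans_le hx), zero_mul, zero_mul]
    · exact mul_le_mul_of_nonneg_left hx (bump_nonneg _ _)
  have hflux : bump (R - t) x * -(x ⬝ᵥ crossProduct (U x) (V x)) ≤
      bump (R - t) x * (‖x‖ * energy U V x) :=
    mul_le_mul_of_nonneg_left ((neg_le_abs _).trans
      (abs_dotProduct_crossProduct_le_norm_mul_energy U V x x)) (bump_nonneg _ _)
  rw [hgrad, smul_dotProduct, smul_eq_mul]
  linarith [mul_le_mul_of_nonneg_right hcone (energy_nonneg U V x)]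

theorem integral_deriv_coneEnergy_nonpos (h : IsMaxwellSolution 1 (Set.Ioo 0 R) E B)
    (ht : t ∈ Set.Ioo 0 R) :
    ∫ x, (4 * (t - R) * bump (R - t) x * energy (E t) (B t) x -
      bump (R - t) x ^ 2 * div (fun y => crossProduct (E t y) (B t y)) x) ≤ 0 := by
  have hE := contDiff_pi.1 (contDiff_space_slice h.contDiffOn_E ht)
  have hB := contDiff_pi.1 (contDiff_space_slice h.contDiffOn_B ht)
  have hP := contDiff_bump_sq (R - t)
  have hPs := hasCompactSupport_bump_sq (R - t)
  have hcross : ContDiff ℝ 1 fun x => crossProduct (E t x) (B t x) := by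
    refine contDiff_pi.2 fun i => ?_
    fin_cases i <;> exact ((hE _).mul (hB _)).sub ((hE _).mul (hB _))
  have hslice : Continuous fun x : Space => (t, x) := Continuous.prodMk_right t
  have henergy : Continuous (energy (E t) (B t)) :=
    (continuousOn_uncurry_energy h).comp_continuous hslice fun _ => ⟨ht, Set.mem_univ _⟩
  have hdiv : Continuous (div fun x => crossProduct (E t x) (B t x)) :=
    (continuousOn_uncurry_div_crossProduct isOpen_Ioo h).comp_continuous hslice
      fun _ => ⟨ht, Set.mem_univ _⟩
  have hpd : ∀ i, Continuous (pd i fun x => bump (R - t) x ^ 2) := fun i =>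
    (hP.continuous_fderiv one_ne_zero).clm_apply continuous_const
  have hint_energy : Integrable fun x => 4 * (t - R) * bump (R - t) x * energy (E t) (B t) x :=
    ((continuous_const.mul (continuous_bump _)).mul henergy).integrable_of_hasCompactSupport
      (hasCompactSupport_bump _).mul_left.mul_right
  have hint_div : Integrable fun x =>
      bump (R - t) x ^ 2 * div (fun y => crossProduct (E t y) (B t y)) x :=
    (hP.continuous.mul hdiv).integrable_of_hasCompactSupport hPs.mul_right
  have hint_flux : Integrable fun x => (fun i => pd i (fun y => bump (R - t) y ^ 2) x) ⬝ᵥ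
      crossProduct (E t x) (B t x) :=
    integrable_finsetSum _ fun i _ => ((hpd i).mul (contDiff_pi.1 hcross i).continuous
      ).integrable_of_hasCompactSupport (hPs.fderiv_apply ℝ _).mul_right
  rw [integral_sub hint_energy hint_div, integral_mul_div_eq_neg hP hPs hcross, sub_neg_eq_add,
    ← integral_add hint_energy hint_flux]
  exact integral_nonpos fun x => energy_add_flux_nonpos ht.2.le (E t) (B t) x

theorem IsMaxwellSolution.of_le {r s : WithTop ℕ∞} {J : Set ℝ} (h : IsMaxwellSolution r J E B)
    (hsr : s ≤ r) : IsMaxwellSolution s J E B :=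
  { h with
    contDiffOn_E := h.contDiffOn_E.of_le hsr
    contDiffOn_B := h.contDiffOn_B.of_le hsr }

theorem IsMaxwellSolution.mono {r : WithTop ℕ∞} {J J' : Set ℝ} (h : IsMaxwellSolution r J' E B)
    (hr : 1 ≤ r) (hJ : UniqueDiffOn ℝ J) (hJJ' : J ⊆ J') : IsMaxwellSolution r J E B := by
  have hderiv : ∀ {U : ℝ → Space → Fin 3 → ℝ},
      ContDiffOn ℝ r (fun p : ST => U p.1 p.2) (J' ×ˢ Set.univ) → ∀ s ∈ J, ∀ x,
        derivWithin (fun s => U s x) J s = derivWithin (fun s => U s x) J' s := fun hU s hs x =>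
    derivWithin_subset hJJ' (hJ s hs) ((contDiffOn_time_slice hU x).differentiableOn
      (zero_lt_one.trans_le hr).ne' s (hJJ' hs))
  exact
    { contDiffOn_E := h.contDiffOn_E.mono (Set.prod_mono_left hJJ')
      contDiffOn_B := h.contDiffOn_B.mono (Set.prod_mono_left hJJ')
      div_E := fun s hs => h.div_E s (hJJ' hs)
      div_B := fun s hs => h.div_B s (hJJ' hs)
      ampere := fun s hs x => by rw [hderiv h.contDiffOn_E s hs, h.ampere s (hJJ' hs)]
      faraday := fun s hs x => by rw [hderiv h.contDiffOn_B s hs, h.faraday s (hJJ' hs)] }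

theorem antitoneOn_coneEnergy (h : IsMaxwellSolution 1 (Set.Ici 0) E B) :
    AntitoneOn (coneEnergy R E B) (Set.Icc 0 R) := by
  have hIoo : IsMaxwellSolution 1 (Set.Ioo 0 R) E B :=
    h.mono le_rfl isOpen_Ioo.uniqueDiffOn fun s hs => hs.1.le
  refine antitoneOn_of_deriv_nonpos (convex_Icc 0 R) (continuousOn_coneEnergy h) ?_ ?_ <;>
    rw [interior_Icc]
  · exact fun s hs => (hasDerivAt_coneEnergy hIoo hs).differentiableAt.differentiableWithinAt
  · intro s hs
    rw [(hasDerivAt_coneEnergy hIoo hs).deriv]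
    exact integral_deriv_coneEnergy_nonpos hIoo hs

theorem IsMaxwellSolution.eq_zero_of_initial_eq_zero (h : IsMaxwellSolution 1 (Set.Ici 0) E B)
    (hE : E 0 = 0) (hB : B 0 = 0) (ht : 0 ≤ t) : E t = 0 ∧ B t = 0 := by
  suffices hpoint : ∀ x, E t x = 0 ∧ B t x = 0 from
    ⟨funext fun x => (hpoint x).1, funext fun x => (hpoint x).2⟩
  intro x
  by_contra hne
  have hinit : coneEnergy (t + ‖x‖ + 1) E B 0 = 0 := by
    simp [coneEnergy, energy, hE, hB]
  have hanti : coneEnergy (t + ‖x‖ + 1) E B t ≤ coneEnergy (t + ‖x‖ + 1) E B 0 :=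
    antitoneOn_coneEnergy h ⟨le_rfl, by positivity⟩ ⟨ht, by linarith [norm_nonneg x]⟩ ht
  have hbump : bump (t + ‖x‖ + 1 - t) x ≠ 0 := by
    refine (lt_max_of_lt_right (sub_pos.2 ?_)).ne'
    exact pow_lt_pow_left₀ (by linarith) (norm_nonneg x) two_ne_zero
  have henergy : Continuous (energy (E t) (B t)) :=
    (continuousOn_uncurry_energy h).comp_continuous (Continuous.prodMk_right t)
      fun _ => ⟨ht, Set.mem_univ _⟩
  have hpos : 0 < coneEnergy (t + ‖x‖ + 1) E B t :=
    ((continuous_bump_sq _).mul henergy).integral_pos_of_hasCompactSupport_nonneg_nonzero (x := x)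
      (hasCompactSupport_bump_sq _).mul_right
      (fun y => mul_nonneg (sq_nonneg _) (energy_nonneg _ _ y))
      (mul_ne_zero (pow_ne_zero 2 hbump) fun h0 => hne (energy_eq_zero_iff.1 h0))
  linarith

end LightConeEnergy

section Uniqueness

variable {E B E' B' : ℝ → Space → Fin 3 → ℝ} {J : Set ℝ} {r : WithTop ℕ∞} {t : ℝ}

theorem div_sub {U V : Space → Fin 3 → ℝ} (hU : Differentiable ℝ U) (hV : Differentiable ℝ V)
    (x : Space) : div (fun y => U y - V y) x = div U x - div V x := by
  refine (Finset.sum_congr rfl fun i _ => congrFun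
    (dirDeriv_sub (differentiable_pi.1 hU i) (differentiable_pi.1 hV i) _) x).trans ?_
  exact Finset.sum_sub_distrib _ _

theorem curl_sub {U V : Space → Fin 3 → ℝ} (hU : Differentiable ℝ U) (hV : Differentiable ℝ V)
    (x : Space) : curl (fun y => U y - V y) x = curl U x - curl V x := by
  have hpd : ∀ i j, pd i (fun y => U y j - V y j) x = pd i (U · j) x - pd i (V · j) x :=
    fun i j => congrFun (dirDeriv_sub (differentiable_pi.1 hU j) (differentiable_pi.1 hV j) _) x
  funext i
  simp only [curl_apply, Pi.sub_apply, hpd]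
  abel

theorem pd_neg (f : Space → ℝ) (i : Fin 3) (x : Space) : pd i (fun y => -f y) x = -pd i f x := by
  simp [pd]

theorem div_neg (V : Space → Fin 3 → ℝ) (x : Space) : div (fun y => -V y) x = -div V x := by
  simp only [div, Pi.neg_apply, pd_neg, Finset.sum_neg_distrib]

theorem curl_neg (V : Space → Fin 3 → ℝ) (x : Space) : curl (fun y => -V y) x = -curl V x := by
  funext i
  simp only [curl_apply, Pi.neg_apply, pd_neg]
  ring

theorem IsMaxwellSolution.sub (h : IsMaxwellSolution r J E B) (h' : IsMaxwellSolution r J E' B')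
    (hr : 1 ≤ r) :
    IsMaxwellSolution r J (fun t x => E t x - E' t x) (fun t x => B t x - B' t x) := by
  have hr₀ : r ≠ 0 := (zero_lt_one.trans_le hr).ne'
  have hspace : ∀ {U : ℝ → Space → Fin 3 → ℝ},
      ContDiffOn ℝ r (fun p : ST => U p.1 p.2) (J ×ˢ Set.univ) → ∀ t ∈ J, Differentiable ℝ (U t) :=
    fun hU t ht => (contDiff_space_slice hU ht).differentiable hr₀
  have htime : ∀ {U : ℝ → Space → Fin 3 → ℝ},
      ContDiffOn ℝ r (fun p : ST => U p.1 p.2) (J ×ˢ Set.univ) →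
        ∀ t ∈ J, ∀ x, DifferentiableWithinAt ℝ (fun s => U s x) J t :=
    fun hU t ht x => (contDiffOn_time_slice hU x).differentiableOn hr₀ t ht
  refine ⟨h.contDiffOn_E.sub h'.contDiffOn_E, h.contDiffOn_B.sub h'.contDiffOn_B,
    fun t ht x => ?_, fun t ht x => ?_, fun t ht x => ?_, fun t ht x => ?_⟩
  · rw [div_sub (hspace h.contDiffOn_E t ht) (hspace h'.contDiffOn_E t ht), h.div_E t ht,
      h'.div_E t ht, sub_zero]
  · rw [div_sub (hspace h.contDiffOn_B t ht) (hspace h'.contDiffOn_B t ht), h.div_B t ht,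
      h'.div_B t ht, sub_zero]
  · rw [derivWithin_fun_sub (htime h.contDiffOn_E t ht x) (htime h'.contDiffOn_E t ht x),
      curl_sub (hspace h.contDiffOn_B t ht) (hspace h'.contDiffOn_B t ht), h.ampere t ht,
      h'.ampere t ht]
  · rw [derivWithin_fun_sub (htime h.contDiffOn_B t ht x) (htime h'.contDiffOn_B t ht x),
      curl_sub (hspace h.contDiffOn_E t ht) (hspace h'.contDiffOn_E t ht), h.faraday t ht,
      h'.faraday t ht, neg_sub_neg, neg_sub]

theorem IsMaxwellSolution.timeReverse (h : IsMaxwellSolution r Set.univ E B) :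
    IsMaxwellSolution r Set.univ (fun t => E (-t)) (fun t x => -B (-t) x) := by
  have hneg : ∀ {U : ℝ → Space → Fin 3 → ℝ},
      ContDiffOn ℝ r (fun p : ST => U p.1 p.2) (Set.univ ×ˢ Set.univ) →
        ContDiffOn ℝ r (fun p : ST => U (-p.1) p.2) (Set.univ ×ˢ Set.univ) := fun hU =>
    hU.comp (contDiff_fst.neg.prodMk contDiff_snd).contDiffOn fun _ _ => ⟨trivial, trivial⟩
  have hderiv : ∀ (U : ℝ → Space → Fin 3 → ℝ) (t : ℝ) (x : Space),
      derivWithin (fun s => U (-s) x) Set.univ t = -derivWithin (fun s => U s x) Set.univ (-t) :=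
    fun U t x => by rw [derivWithin_univ, derivWithin_univ, deriv_comp_neg fun s => U s x]
  refine ⟨hneg h.contDiffOn_E, (hneg h.contDiffOn_B).neg, fun t _ x => h.div_E (-t) trivial x,
    fun t _ x => ?_, fun t _ x => ?_, fun t _ x => ?_⟩
  · rw [div_neg, h.div_B (-t) trivial, neg_zero]
  · rw [hderiv, h.ampere (-t) trivial, curl_neg]
  · rw [derivWithin.fun_neg, hderiv, h.faraday (-t) trivial, neg_neg]

theorem IsMaxwellSolution.eq_zero_of_initial_eq_zero_of_univ
    (h : IsMaxwellSolution 1 Set.univ E B) (hE : E 0 = 0) (hB : B 0 = 0) (t : ℝ) :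
    E t = 0 ∧ B t = 0 := by
  have hIci : UniqueDiffOn ℝ (Set.Ici (0 : ℝ)) := uniqueDiffOn_Ici 0
  rcases le_total 0 t with ht | ht
  · exact (h.mono le_rfl hIci (Set.subset_univ _)).eq_zero_of_initial_eq_zero hE hB ht
  · have hreverse := (h.timeReverse.mono le_rfl hIci (Set.subset_univ _)).eq_zero_of_initial_eq_zero
      (t := -t) (by simpa using hE) (by simp [hB, funext_iff]) (neg_nonneg.2 ht)
    simp only [neg_neg] at hreverse
    exact ⟨hreverse.1, funext fun x => neg_eq_zero.1 (congrFun hreverse.2 x)⟩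

theorem IsMaxwellSolution.unique (hJ : J = Set.Ici 0 ∨ J = Set.univ) (hr : 1 ≤ r)
    (h : IsMaxwellSolution r J E B) (h' : IsMaxwellSolution r J E' B') (hE : E 0 = E' 0)
    (hB : B 0 = B' 0) (ht : t ∈ J) : E t = E' t ∧ B t = B' t := by
  have hdiff := (h.sub h' hr).of_le hr
  have hE₀ : (fun x => E 0 x - E' 0 x) = 0 := by rw [hE]; exact funext fun x => sub_self _
  have hB₀ : (fun x => B 0 x - B' 0 x) = 0 := by rw [hB]; exact funext fun x => sub_self _
  have hzero : (fun x => E t x - E' t x) = 0 ∧ (fun x => B t x - B' t x) = 0 := by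
    rcases hJ with rfl | rfl
    · exact hdiff.eq_zero_of_initial_eq_zero hE₀ hB₀ ht
    · exact hdiff.eq_zero_of_initial_eq_zero_of_univ hE₀ hB₀ t
  exact ⟨sub_eq_zero.1 hzero.1, sub_eq_zero.1 hzero.2⟩

end Uniqueness

section OrderInTime

variable {A : Type*} [NormedAddCommGroup A] [NormedSpace ℝ A]

theorem RealAnalytic.time_slice {u : ST → A} (hu : RealAnalytic u) (x : Space) :
    RealAnalytic fun t => u (t, x) := fun t _ =>
  (hu (t, x) (Set.mem_univ _)).comp (f := fun t : ℝ => ((t, x) : ST))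
    (analyticAt_id.prod analyticAt_const)

/-- The order of vanishing of `u` at time `0` along the time axis through `x`. -/
def timeOrder (u : ST → A) (x : Space) : ℕ∞ := analyticOrderAt (fun t => u (t, x)) 0

variable {u v : ST → A} {U : Set Space} {x : Space} {n : ℕ∞}

theorem timeOrder_dirDeriv_eT_add_one [CompleteSpace A] (hu : RealAnalytic u)
    (h₀ : u (0, x) = 0) : timeOrder (dirDeriv eT u) x + 1 = timeOrder u x := by
  have hderiv : deriv (fun t => u (t, x)) = fun t => dirDeriv eT u (t, x) :=
    funext fun t => (hasDerivAt_time hu.differentiable t x).deriv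
  have h := (hu.time_slice x 0 (Set.mem_univ _)).analyticOrderAt_deriv_add_one
  rw [hderiv] at h
  simpa only [timeOrder, h₀, sub_zero] using h

theorem le_timeOrder_add (hu : n ≤ timeOrder u x) (hv : n ≤ timeOrder v x) :
    n ≤ timeOrder (fun p => u p + v p) x :=
  (le_min hu hv).trans le_analyticOrderAt_add

theorem le_timeOrder_zero : n ≤ timeOrder (fun _ => (0 : A)) x := by
  rw [timeOrder, analyticOrderAt_eq_top.2 (Eventually.of_forall fun _ => rfl)]
  exact le_top

theorem le_timeOrder_sum {ι : Type*} (s : Finset ι) {w : ι → ST → A}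
    (hw : ∀ i ∈ s, n ≤ timeOrder (w i) x) : n ≤ timeOrder (fun p => ∑ i ∈ s, w i p) x := by
  classical
  induction s using Finset.induction_on with
  | empty => exact le_timeOrder_zero
  | insert i s hi ih =>
    have hsum : (fun p => ∑ j ∈ insert i s, w j p) = fun p => w i p + ∑ j ∈ s, w j p :=
      funext fun p => Finset.sum_insert hi
    rw [hsum]
    exact le_timeOrder_add (hw i (Finset.mem_insert_self i s))
      (ih fun j hj => hw j (Finset.mem_insert_of_mem hj))

theorem le_timeOrder_mul {𝕜 : Type*} [NormedRing 𝕜] [NormedAlgebra ℝ 𝕜] {c w : ST → 𝕜} {n : ℕ}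
    (hc : AnalyticAt ℝ (fun t => c (t, x)) 0) (hw : RealAnalytic w) (hn : n ≤ timeOrder w x) :
    n ≤ timeOrder (fun p => c p * w p) x := by
  have hw₀ := hw.time_slice x 0 (Set.mem_univ _)
  obtain ⟨q, hq, hwq⟩ := (natCast_le_analyticOrderAt hw₀).1 hn
  refine (natCast_le_analyticOrderAt (hc.mul hw₀)).2 ⟨fun t => c (t, x) * q t, hc.mul hq, ?_⟩
  filter_upwards [hwq] with t ht
  rw [Pi.mul_apply, ht, mul_smul_comm]

theorem le_timeOrder_dirDeriv_eX [CompleteSpace A] (hU : IsOpen U) {n : ℕ} (hu : RealAnalytic u)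
    (hn : ∀ x ∈ U, n ≤ timeOrder u x) (i : Fin 3) :
    ∀ x ∈ U, n ≤ timeOrder (dirDeriv (eX i) u) x := by
  induction n generalizing u with
  | zero => exact fun x _ => zero_le
  | succ n ih =>
    have h₀ : ∀ x ∈ U, u (0, x) = 0 := fun x hx =>
      apply_eq_zero_of_analyticOrderAt_ne_zero (f := fun t => u (t, x))
        (ne_bot_of_le_ne_bot (by simp) (hn x hx))
    have hderiv : ∀ x ∈ U, n ≤ timeOrder (dirDeriv eT u) x := fun x hx => by
      have h := hn x hx
      rw [← timeOrder_dirDeriv_eT_add_one hu (h₀ x hx)] at h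
      push_cast at h
      exact (ENat.add_le_add_iff_right ENat.one_ne_top).1 h
    intro x hx
    have hx₀ : dirDeriv (eX i) u (0, x) = 0 := by
      rw [← pd_slice hu.differentiable]
      have hzero : (fun y => u (0, y)) =ᶠ[𝓝 x] fun _ => 0 :=
        eventually_of_mem (hU.mem_nhds hx) h₀
      rw [pd, hzero.fderiv_eq, fderiv_const_apply, zero_apply]
    rw [← timeOrder_dirDeriv_eT_add_one (hu.dirDeriv _) hx₀, dirDeriv_comm hu.contDiff]
    push_cast
    exact add_le_add_left (ih (hu.dirDeriv eT) hderiv x hx) 1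

theorem eq_zero_of_forall_le_timeOrder (hU : IsOpen U) (hne : U.Nonempty) (hu : RealAnalytic u)
    (hn : ∀ n : ℕ, ∀ x ∈ U, n ≤ timeOrder u x) : u = 0 := by
  have hline : ∀ x ∈ U, ∀ t, u (t, x) = 0 := fun x hx t => by
    have htop : timeOrder u x = ⊤ := ENat.eq_top_iff_forall_ge.2 fun n => hn n x hx
    exact (hu.time_slice x).eqOn_zero_of_preconnected_of_eventuallyEq_zero isPreconnected_univ
      (Set.mem_univ 0) (analyticOrderAt_eq_top.1 htop) (Set.mem_univ t)
  obtain ⟨x₀, hx₀⟩ := hne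
  have hlocal : u =ᶠ[𝓝 ((0 : ℝ), x₀)] 0 :=
    eventually_of_mem ((isOpen_univ.prod hU).mem_nhds ⟨Set.mem_univ 0, hx₀⟩)
      fun p hp => hline p.2 hp.2 p.1
  exact funext fun p => hu.eqOn_zero_of_preconnected_of_eventuallyEq_zero isPreconnected_univ
    (Set.mem_univ _) hlocal (Set.mem_univ p)

end OrderInTime

section WaveUniqueness

variable {𝕜 : Type*} [NormedField 𝕜] [NormedAlgebra ℝ 𝕜] [CompleteSpace 𝕜]
  {c α γ u : ST → 𝕜} {β : Fin 3 → ST → 𝕜} {U : Set Space}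

/- Solving for `∂ₜ²u`, the right-hand side vanishes to one order more than known for `∂ₜ²u`. -/
theorem le_timeOrder_add_one_of_wave (hU : IsOpen U) (hc : RealAnalytic c) (hα : RealAnalytic α)
    (hγ : RealAnalytic γ) (hβ : ∀ j, RealAnalytic (β j)) (hu : RealAnalytic u)
    (hwave : ∀ p, c p * (dirDeriv eT (dirDeriv eT u) p - stLap u p) =
      α p * u p + γ p * dirDeriv eT u p + ∑ j, β j p * dirDeriv (eX j) u p)
    (hcU : ∀ x ∈ U, c (0, x) ≠ 0) (h₀ : ∀ x, u (0, x) = 0) (h₁ : ∀ x, dirDeriv eT u (0, x) = 0)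
    {n : ℕ} (hn : ∀ x ∈ U, (n + 1 : ℕ) ≤ timeOrder (dirDeriv eT u) x) :
    ∀ x ∈ U, (n + 2 : ℕ) ≤ timeOrder (dirDeriv eT u) x := by
  have hslice : ∀ {f : ST → 𝕜}, RealAnalytic f → ∀ x, AnalyticAt ℝ (fun t => f (t, x)) 0 :=
    fun hf x => hf.time_slice x 0 (Set.mem_univ _)
  have hu_order : ∀ x ∈ U, (n + 1 : ℕ) ≤ timeOrder u x := fun x hx => by
    rw [← timeOrder_dirDeriv_eT_add_one hu (h₀ x)]
    exact (hn x hx).trans le_self_add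
  have hgrad : ∀ j, ∀ x ∈ U, (n + 1 : ℕ) ≤ timeOrder (dirDeriv (eX j) u) x :=
    le_timeOrder_dirDeriv_eX hU hu hu_order
  have hlap : ∀ x ∈ U, (n + 1 : ℕ) ≤ timeOrder (stLap u) x := fun x hx =>
    le_timeOrder_sum _ fun j _ =>
      le_timeOrder_dirDeriv_eX hU (hu.dirDeriv (eX j)) (hgrad j) j x hx
  intro x hx
  have hlower : (n + 1 : ℕ) ≤ timeOrder (fun p => α p * u p + γ p * dirDeriv eT u p +
      ∑ j, β j p * dirDeriv (eX j) u p) x :=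
    le_timeOrder_add (le_timeOrder_add (le_timeOrder_mul (hslice hα x) hu (hu_order x hx))
      (le_timeOrder_mul (hslice hγ x) (hu.dirDeriv eT) (hn x hx)))
      (le_timeOrder_sum _ fun j _ =>
        le_timeOrder_mul (hslice (hβ j) x) (hu.dirDeriv _) (hgrad j x hx))
  have hbox : RealAnalytic fun p => dirDeriv eT (dirDeriv eT u) p - stLap u p :=
    ((hu.dirDeriv _).dirDeriv _).sub (RealAnalytic.stLap hu)
  have hbox_order : (n + 1 : ℕ) ≤
      timeOrder (fun p => dirDeriv eT (dirDeriv eT u) p - stLap u p) x := by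
    simp only [← hwave] at hlower
    have hinv := le_timeOrder_mul (c := fun p => (c p)⁻¹) ((hslice hc x).inv (hcU x hx))
      (hc.mul hbox) hlower
    refine hinv.trans_eq (analyticOrderAt_congr ?_)
    filter_upwards [(hslice hc x).continuousAt.eventually_ne (hcU x hx)] with t ht
    exact inv_mul_cancel_left₀ ht _
  have htt : (n + 1 : ℕ) ≤ timeOrder (dirDeriv eT (dirDeriv eT u)) x := by
    simpa only [sub_add_cancel] using le_timeOrder_add hbox_order (hlap x hx)
  rw [← timeOrder_dirDeriv_eT_add_one (hu.dirDeriv eT) (h₁ x)]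
  exact_mod_cast add_le_add_left htt 1

theorem eq_zero_of_wave (hc : RealAnalytic c) (hα : RealAnalytic α)
    (hγ : RealAnalytic γ) (hβ : ∀ j, RealAnalytic (β j)) (hu : RealAnalytic u)
    (hwave : ∀ p, c p * (dirDeriv eT (dirDeriv eT u) p - stLap u p) =
      α p * u p + γ p * dirDeriv eT u p + ∑ j, β j p * dirDeriv (eX j) u p)
    (h₀ : ∀ x, u (0, x) = 0) (h₁ : ∀ x, dirDeriv eT u (0, x) = 0) {x₀ : Space}
    (hx₀ : c (0, x₀) ≠ 0) : u = 0 := by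
  have hU : IsOpen {x | c (0, x) ≠ 0} :=
    isOpen_ne_fun (hc.differentiable.continuous.comp (Continuous.prodMk_right 0)) continuous_const
  have hinit : ∀ x, (1 : ℕ) ≤ timeOrder (dirDeriv eT u) x := fun x => by
    rw [← timeOrder_dirDeriv_eT_add_one (hu.dirDeriv eT) (h₁ x), Nat.cast_one]
    exact le_add_self
  have horder : ∀ n : ℕ, ∀ x ∈ {x | c (0, x) ≠ 0},
      (n + 1 : ℕ) ≤ timeOrder (dirDeriv eT u) x := by
    intro n
    induction n with
    | zero => exact fun x _ => hinit x
    | succ n ih =>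
      exact le_timeOrder_add_one_of_wave hU hc hα hγ hβ hu hwave (fun _ hx => hx) h₀ h₁ ih
  refine eq_zero_of_forall_le_timeOrder hU ⟨x₀, hx₀⟩ hu fun n x hx => ?_
  rw [← timeOrder_dirDeriv_eT_add_one hu (h₀ x)]
  exact (Nat.cast_le.2 n.le_succ).trans ((horder n x hx).trans le_self_add)

end WaveUniqueness

section NullPropagation

/- For null `F` with gradient `g` and curl `c`, all terms on the right vanish to first order with
`F · F`: `∑ j, f j * g i j` is half its gradient, and `F · c` is a multiple of its time derivative
under Maxwell's equations. -/
theorem sq_mul_curl_sq_add_gradient_sq {R : Type*} [CommRing R] (f c : Fin 3 → R)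
    (g : Fin 3 → Fin 3 → R) (hc : ∀ i, c i = g (i + 1) (i + 2) - g (i + 2) (i + 1))
    (htrace : ∑ i, g i i = 0) (k : Fin 3) :
    f k ^ 2 * (∑ i, c i ^ 2 + ∑ i, ∑ j, g i j ^ 2) =
      (∑ i, ∑ j, g i j * g j i - 4 * ∑ j, g k j * g j k + 2 * ∑ j, g k j ^ 2) * ∑ i, f i * f i +
      2 * (f (k + 1) * g k (k + 2) - f (k + 2) * g k (k + 1) + f k * c k) * ∑ i, f i * c i +
      2 * ∑ i, (f k * (g k i + g i k) - ∑ j, f j * g j i - g k k * f i +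
        if i = k then 2 * ∑ j, f j * g j k - ∑ j, g k j * f j else 0) * ∑ j, f j * g i j := by
  have h₂₂ : g 2 2 = -g 0 0 - g 1 1 := by
    rw [Fin.sum_univ_three] at htrace
    linear_combination htrace
  simp only [hc, Fin.sum_univ_three]
  fin_cases k <;>
    simp only [Fin.zero_eta, Fin.mk_one, Fin.reduceFinMk, Fin.isValue, Fin.reduceAdd, h₂₂,
      Fin.reduceEq, if_true, if_false] <;>
    ring

/-- The complex bilinear square `F · F` of a field on space-time, given by its components. -/
def complexSquare (F : Fin 3 → ST → ℂ) (p : ST) : ℂ := ∑ i, F i p * F i p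

variable {F : Fin 3 → ST → ℂ}

theorem RealAnalytic.complexSquare (hF : ∀ i, RealAnalytic (F i)) :
    RealAnalytic (complexSquare F) :=
  Finset.univ.analyticOnNhd_fun_sum fun i _ => (hF i).mul (hF i)

theorem dirDeriv_complexSquare (hF : ∀ i, Differentiable ℝ (F i)) (v : ST) :
    dirDeriv v (complexSquare F) = fun p => 2 * ∑ i, F i p * dirDeriv v (F i) p := by
  refine (dirDeriv_sum (fun i _ => (hF i).fun_mul (hF i)) v).trans ?_
  funext p
  rw [Finset.mul_sum]
  exact Finset.sum_congr rfl fun i _ => by rw [dirDeriv_mul (hF i) (hF i)]; ring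

theorem dirDeriv_dirDeriv_complexSquare (hF : ∀ i, RealAnalytic (F i)) (v : ST) (p : ST) :
    dirDeriv v (dirDeriv v (complexSquare F)) p =
      2 * ∑ i, (F i p * dirDeriv v (dirDeriv v (F i)) p + dirDeriv v (F i) p ^ 2) := by
  have hd : ∀ i, Differentiable ℝ (F i) := fun i => (hF i).differentiable
  have hd' : ∀ i, Differentiable ℝ (dirDeriv v (F i)) := fun i => ((hF i).dirDeriv v).differentiable
  rw [dirDeriv_complexSquare hd]
  refine (congrFun (dirDeriv_const_smul
    (Differentiable.fun_sum fun i _ => (hd i).fun_mul (hd' i)) (2 : ℂ) v) p).trans ?_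
  rw [dirDeriv_sum fun i _ => (hd i).fun_mul (hd' i), smul_eq_mul]
  simp only [dirDeriv_mul (hd _) (hd' _), pow_two]

namespace IsAnalyticMaxwell

theorem wave (hF : IsAnalyticMaxwell F) (i : Fin 3) (p : ST) :
    dirDeriv eT (dirDeriv eT (F i)) p = stLap (F i) p := by
  have hcurl : ∀ j, Differentiable ℝ (stCurl F j) := fun j =>
    (RealAnalytic.stCurl hF.analytic j).differentiable
  have htime : ∀ j, dirDeriv eT (F j) = fun q => -Complex.I • stCurl F j q := fun j =>
    funext (hF.dirDeriv_eT j)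
  have hcurl_time : stCurl (fun j => dirDeriv eT (F j)) i p =
      -Complex.I * stCurl (stCurl F) i p := by
    rw [stCurl, htime, htime, dirDeriv_const_smul (hcurl _), dirDeriv_const_smul (hcurl _)]
    exact (mul_sub _ _ _).symm
  rw [htime, dirDeriv_const_smul (hcurl i)]
  simp only [dirDeriv_stCurl hF.analytic, hcurl_time, smul_eq_mul]
  rw [stCurl_stCurl hF.analytic (funext hF.div_eq_zero)]
  linear_combination (-stLap (F i) p) * Complex.I_mul_I

theorem dirDeriv_eT_complexSquare (hF : IsAnalyticMaxwell F) (p : ST) :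
    dirDeriv eT (complexSquare F) p = -2 * Complex.I * ∑ i, F i p * stCurl F i p := by
  rw [dirDeriv_complexSquare fun i => (hF.analytic i).differentiable]
  simp only [hF.dirDeriv_eT, Finset.mul_sum]
  exact Finset.sum_congr rfl fun i _ => by ring

theorem wave_complexSquare (hF : IsAnalyticMaxwell F) (p : ST) :
    dirDeriv eT (dirDeriv eT (complexSquare F)) p - stLap (complexSquare F) p =
      -2 * (∑ i, stCurl F i p ^ 2 + ∑ i, ∑ j, dirDeriv (eX i) (F j) p ^ 2) := by
  simp only [stLap, dirDeriv_dirDeriv_complexSquare hF.analytic, hF.wave, hF.dirDeriv_eT,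
    Fin.sum_univ_three]
  linear_combination 2 * (stCurl F 0 p ^ 2 + stCurl F 1 p ^ 2 + stCurl F 2 p ^ 2) * Complex.I_sq

theorem exists_wave_complexSquare (hF : IsAnalyticMaxwell F) (k : Fin 3) :
    ∃ (α γ : ST → ℂ) (β : Fin 3 → ST → ℂ),
      RealAnalytic α ∧ RealAnalytic γ ∧ (∀ j, RealAnalytic (β j)) ∧ ∀ p,
        F k p ^ 2 * (dirDeriv eT (dirDeriv eT (complexSquare F)) p - stLap (complexSquare F) p) =
          α p * complexSquare F p + γ p * dirDeriv eT (complexSquare F) p +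
            ∑ j, β j p * dirDeriv (eX j) (complexSquare F) p := by
  set g : Fin 3 → Fin 3 → ST → ℂ := fun i j => dirDeriv (eX i) (F j)
  have hf : ∀ i p, AnalyticAt ℝ (F i) p := fun i p => hF.analytic i p (Set.mem_univ p)
  have hg : ∀ i j p, AnalyticAt ℝ (g i j) p := fun i j p =>
    (hF.analytic j).dirDeriv _ p (Set.mem_univ p)
  have hc : ∀ i p, AnalyticAt ℝ (stCurl F i) p := fun i p =>
    RealAnalytic.stCurl hF.analytic i p (Set.mem_univ p)
  refine ⟨fun p => -2 * (∑ i, ∑ j, g i j p * g j i p - 4 * ∑ j, g k j p * g j k p +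
      2 * ∑ j, g k j p ^ 2),
    fun p => -2 * Complex.I * (F (k + 1) p * g k (k + 2) p - F (k + 2) p * g k (k + 1) p +
      F k p * stCurl F k p),
    fun i p => -2 * (F k p * (g k i p + g i k p) - ∑ j, F j p * g j i p - g k k p * F i p +
      if i = k then 2 * ∑ j, F j p * g j k p - ∑ j, g k j p * F j p else 0),
    fun p _ => by fun_prop, fun p _ => by fun_prop, fun i p _ => ?_, fun p => ?_⟩
  · by_cases hik : i = k <;> simp only [hik, if_true, if_false] <;> fun_prop
  · have hidentity := sq_mul_curl_sq_add_gradient_sq (fun i => F i p) (fun i => stCurl F i p)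
      (fun i j => g i j p) (fun _ => rfl) (hF.div_eq_zero p) k
    rw [hF.wave_complexSquare, hF.dirDeriv_eT_complexSquare]
    simp only [dirDeriv_complexSquare fun i => (hF.analytic i).differentiable, mul_assoc (-2 : ℂ),
      mul_left_comm _ (2 : ℂ), ← Finset.mul_sum, complexSquare]
    linear_combination -2 * hidentity - 4 * (F (k + 1) p * g k (k + 2) p -
      F (k + 2) p * g k (k + 1) p + F k p * stCurl F k p) *
        (∑ i, F i p * stCurl F i p) * Complex.I_sq

theorem eq_zero_of_initial_eq_zero (hF : IsAnalyticMaxwell F) (h₀ : ∀ i x, F i (0, x) = 0)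
    (i : Fin 3) (p : ST) : F i p = 0 := by
  obtain ⟨hre, him⟩ :=
    (hF.isMaxwellSolution 1 uniqueDiffOn_univ).eq_zero_of_initial_eq_zero_of_univ
      (funext₂ fun x j => congrArg Complex.re (h₀ j x))
      (funext₂ fun x j => congrArg Complex.im (h₀ j x)) p.1
  exact Complex.ext (congrFun (congrFun hre p.2) i) (congrFun (congrFun him p.2) i)

theorem complexSquare_eq_zero (hF : IsAnalyticMaxwell F) (h₀ : ∀ x, complexSquare F (0, x) = 0)
    (h₁ : ∀ x, ∑ i, F i (0, x) * stCurl F i (0, x) = 0) (p : ST) : complexSquare F p = 0 := by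
  by_cases hzero : ∀ k x, F k (0, x) = 0
  · simp [complexSquare, hF.eq_zero_of_initial_eq_zero hzero]
  · push Not at hzero
    obtain ⟨k, x₀, hx₀⟩ := hzero
    obtain ⟨α, γ, β, hα, hγ, hβ, hwave⟩ := hF.exists_wave_complexSquare k
    exact congrFun (eq_zero_of_wave ((hF.analytic k).pow 2) hα hγ hβ
      (RealAnalytic.complexSquare hF.analytic) hwave h₀
      (fun x => by rw [hF.dirDeriv_eT_complexSquare, h₁, mul_zero]) (pow_ne_zero 2 hx₀)) p

theorem complexSquare_eq_zero_on_iff (hF : IsAnalyticMaxwell F) {J : Set ℝ}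
    (hJ : Set.Ici 0 ⊆ J) :
    ((∀ x, complexSquare F (0, x) = 0) ∧ ∀ x, ∑ i, F i (0, x) * stCurl F i (0, x) = 0) ↔
      ∀ t ∈ J, ∀ x, complexSquare F (t, x) = 0 := by
  refine ⟨fun h t _ x => hF.complexSquare_eq_zero h.1 h.2 (t, x), fun hnull => ?_⟩
  have hnull₀ := hnull 0 (hJ Set.self_mem_Ici)
  refine ⟨hnull₀, fun x => ?_⟩
  have hderiv : HasDerivWithinAt (fun t => complexSquare F (t, x))
      (dirDeriv eT (complexSquare F) (0, x)) (Set.Ici 0) 0 :=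
    (hasDerivAt_time (RealAnalytic.complexSquare hF.analytic).differentiable 0 x).hasDerivWithinAt
  have hconst : HasDerivWithinAt (fun t => complexSquare F (t, x)) 0 (Set.Ici 0) 0 :=
    (hasDerivWithinAt_const 0 _ (0 : ℂ)).congr (fun t ht => hnull t (hJ ht) x) (hnull₀ x)
  have hzero := (uniqueDiffOn_Ici (0 : ℝ) 0 Set.self_mem_Ici).eq_deriv _ hderiv hconst
  rw [hF.dirDeriv_eT_complexSquare] at hzero
  exact (mul_eq_zero.1 hzero).resolve_left (by simp)

end IsAnalyticMaxwell

end NullPropagation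

section PointwiseEquivalence

theorem dotProduct_along (a v : Fin 3 → ℝ) (f : Space → Fin 3 → ℝ) (x : Space) :
    v ⬝ᵥ along a f x = a ⬝ᵥ along v f x - v ⬝ᵥ crossProduct a (curl f x) := by
  simp only [dotProduct, along, Fin.sum_univ_three, curl, cross_apply, Matrix.cons_val]
  ring

theorem dotProduct_along_eq_sum (a v : Fin 3 → ℝ) (f : Space → Fin 3 → ℝ) (x : Space) :
    v ⬝ᵥ along a f x = ∑ j, a j * (v ⬝ᵥ fun i => pd j (fun y => f y i) x) := by
  simp only [dotProduct, along, Finset.mul_sum, mul_left_comm]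
  exact Finset.sum_comm

theorem dotProduct_along_add {f g : Space → Fin 3 → ℝ} {x : Space} (hf : DifferentiableAt ℝ f x)
    (hg : DifferentiableAt ℝ g x) (a : Fin 3 → ℝ) :
    f x ⬝ᵥ along a g x + g x ⬝ᵥ along a f x = ∑ j, a j * pd j (fun y => f y ⬝ᵥ g y) x := by
  have hderiv : ∀ j, pd j (fun y => f y ⬝ᵥ g y) x =
      (f x ⬝ᵥ fun i => pd j (fun y => g y i) x) + g x ⬝ᵥ fun i => pd j (fun y => f y i) x :=
    fun j => by
    have hf' := fun i => (differentiableAt_pi.1 hf i).hasFDerivAt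
    have hg' := fun i => (differentiableAt_pi.1 hg i).hasFDerivAt
    refine (dirDeriv_eq_of_hasFDerivAt
      (HasFDerivAt.fun_sum fun i _ => (hf' i).mul (hg' i)) _).trans ?_
    simp [pd, dotProduct, Finset.sum_add_distrib]
  simp only [hderiv, dotProduct_along_eq_sum, mul_add, Finset.sum_add_distrib]

theorem dotProduct_along_eq_neg {f g : Space → Fin 3 → ℝ} {x : Space}
    (hf : DifferentiableAt ℝ f x) (hg : DifferentiableAt ℝ g x) (h : ∀ y, f y ⬝ᵥ g y = 0)
    (a : Fin 3 → ℝ) : f x ⬝ᵥ along a g x = -(g x ⬝ᵥ along a f x) := by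
  rw [eq_neg_iff_add_eq_zero, dotProduct_along_add hf hg]
  simp [h, pd]

variable {E B : Space → Fin 3 → ℝ} {x : Space}

theorem isNull_iff : IsNull E B ↔ ∀ x, E x ⬝ᵥ E x = B x ⬝ᵥ B x ∧ E x ⬝ᵥ B x = 0 := by
  refine forall_congr' fun x => ?_
  have hsquare : rs E B x ⬝ᵥ rs E B x =
      ((E x ⬝ᵥ E x - B x ⬝ᵥ B x : ℝ) : ℂ) + ((2 * (E x ⬝ᵥ B x) : ℝ) : ℂ) * Complex.I := by
    simp only [rs, dotProduct, Fin.sum_univ_three]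
    push_cast
    linear_combination ((B x 0 : ℂ) ^ 2 + (B x 1 : ℂ) ^ 2 + (B x 2 : ℂ) ^ 2) * Complex.I_sq
  rw [hsquare, Complex.ext_iff]
  simp [sub_eq_zero]

theorem pd_rs (hE : DifferentiableAt ℝ E x) (hB : DifferentiableAt ℝ B x) (i j : Fin 3) :
    pd j (fun y => rs E B y i) x =
      (pd j (fun y => E y i) x : ℝ) + Complex.I * (pd j (fun y => B y i) x : ℝ) := by
  refine (dirDeriv_eq_of_hasFDerivAt
    ((Complex.ofRealCLM.hasFDerivAt.comp x (differentiableAt_pi.1 hE i).hasFDerivAt).add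
      ((Complex.ofRealCLM.hasFDerivAt.comp x (differentiableAt_pi.1 hB i).hasFDerivAt).const_mul
        Complex.I)) _).trans ?_
  simp [pd]

theorem curl_rs (hE : DifferentiableAt ℝ E x) (hB : DifferentiableAt ℝ B x) (i : Fin 3) :
    curl (rs E B) x i = (curl E x i : ℝ) + Complex.I * (curl B x i : ℝ) := by
  simp only [curl_apply, pd_rs hE hB]
  push_cast
  ring

theorem rs_dotProduct_curl_eq_zero_iff (hE : DifferentiableAt ℝ E x)
    (hB : DifferentiableAt ℝ B x) :
    rs E B x ⬝ᵥ curl (rs E B) x = 0 ↔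
      E x ⬝ᵥ curl E x = B x ⬝ᵥ curl B x ∧ E x ⬝ᵥ curl B x + B x ⬝ᵥ curl E x = 0 := by
  have hsplit : rs E B x ⬝ᵥ curl (rs E B) x =
      ((E x ⬝ᵥ curl E x - B x ⬝ᵥ curl B x : ℝ) : ℂ) +
        ((E x ⬝ᵥ curl B x + B x ⬝ᵥ curl E x : ℝ) : ℂ) * Complex.I := by
    simp only [dotProduct, Fin.sum_univ_three, curl_rs hE hB, rs]
    push_cast
    linear_combination (B x 0 * curl B x 0 + B x 1 * curl B x 1 + B x 2 * curl B x 2 : ℂ) *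
      Complex.I_sq
  rw [hsplit, Complex.ext_iff]
  simp [sub_eq_zero]

theorem dotProduct_poynting_left (x : Space) : E x ⬝ᵥ poynting E B x = 0 := by
  rw [poynting, dotProduct_smul, dot_self_cross, smul_zero]

theorem dotProduct_poynting_right (x : Space) : B x ⬝ᵥ poynting E B x = 0 := by
  rw [poynting, dotProduct_smul, dot_cross_self, smul_zero]

theorem poynting_cross_left (hnull : IsNull E B) (hW : energy E B x ≠ 0) :
    crossProduct (poynting E B x) (E x) = B x := by
  obtain ⟨hnorm, horth⟩ := isNull_iff.1 hnull x
  have henergy : energy E B x = E x ⬝ᵥ E x := by rw [energy, ← hnorm]; ring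
  rw [poynting, LinearMap.map_smul₂, cross_cross_eq_smul_sub_smul, dotProduct_comm (B x), horth,
    zero_smul, sub_zero, ← henergy, inv_smul_smul₀ hW]

theorem poynting_cross_right (hnull : IsNull E B) (hW : energy E B x ≠ 0) :
    crossProduct (poynting E B x) (B x) = -E x := by
  obtain ⟨hnorm, horth⟩ := isNull_iff.1 hnull x
  have henergy : energy E B x = B x ⬝ᵥ B x := by rw [energy, hnorm]; ring
  rw [poynting, LinearMap.map_smul₂, cross_cross_eq_smul_sub_smul, horth, zero_smul, zero_sub,
    ← henergy, smul_neg, inv_smul_smul₀ hW]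

theorem differentiableAt_poynting (hE : DifferentiableAt ℝ E x) (hB : DifferentiableAt ℝ B x)
    (hW : energy E B x ≠ 0) : DifferentiableAt ℝ (poynting E B) x := by
  have hE' := differentiableAt_pi.1 hE
  have hB' := differentiableAt_pi.1 hB
  have henergy : DifferentiableAt ℝ (energy E B) x := by
    unfold energy dotProduct
    fun_prop
  refine (henergy.inv hW).smul (differentiableAt_pi.2 fun i => ?_)
  fin_cases i <;>
    simp only [cross_apply, Fin.zero_eta, Fin.mk_one, Fin.reduceFinMk, Matrix.cons_val] <;> fun_prop

theorem shearFreeAt_iff : ShearFreeAt E B x ↔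
    E x ⬝ᵥ along (E x) (poynting E B) x = B x ⬝ᵥ along (B x) (poynting E B) x ∧
    E x ⬝ᵥ along (B x) (poynting E B) x + B x ⬝ᵥ along (E x) (poynting E B) x = 0 := by
  rw [← sub_eq_zero (b := B x ⬝ᵥ _)]
  simp only [ShearFreeAt, dotProduct, along, Finset.mul_sum, ← Finset.sum_sub_distrib,
    ← Finset.sum_add_distrib, sub_mul, add_mul, mul_assoc, mul_left_comm]

theorem shearFreeAt_iff_conformalFoliationAt (hE : DifferentiableAt ℝ E x)
    (hB : DifferentiableAt ℝ B x) : ShearFreeAt E B x ↔ ConformalFoliationAt E B x := by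
  by_cases hW : energy E B x = 0
  · obtain ⟨hEx, hBx⟩ := energy_eq_zero_iff.1 hW
    simp [ShearFreeAt, ConformalFoliationAt, poynting, hEx, hBx]
  have hV := differentiableAt_poynting hE hB hW
  have hEV := dotProduct_along_eq_neg hE hV dotProduct_poynting_left
  have hBV := dotProduct_along_eq_neg hB hV dotProduct_poynting_right
  rw [shearFreeAt_iff, ConformalFoliationAt, hEV, hEV, hBV, hBV, dotProduct_add, dotProduct_sub,
    neg_inj, ← neg_add, neg_eq_zero, add_comm, sub_eq_zero, and_comm]

theorem conformalFoliationAt_iff_rs_dotProduct_curl_eq_zero (hE : DifferentiableAt ℝ E x)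
    (hB : DifferentiableAt ℝ B x) (hnull : IsNull E B) :
    ConformalFoliationAt E B x ↔ rs E B x ⬝ᵥ curl (rs E B) x = 0 := by
  by_cases hW : energy E B x = 0
  · obtain ⟨hEx, hBx⟩ := energy_eq_zero_iff.1 hW
    simp [rs_dotProduct_curl_eq_zero_iff hE hB, ConformalFoliationAt, poynting, hEx, hBx]
  set V := poynting E B x
  have hVE : ∀ c, V ⬝ᵥ crossProduct (E x) c = B x ⬝ᵥ c := fun c => by
    rw [triple_product_permutation, triple_product_permutation, poynting_cross_left hnull hW,
      dotProduct_comm]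
  have hVB : ∀ c, V ⬝ᵥ crossProduct (B x) c = -(E x ⬝ᵥ c) := fun c => by
    rw [triple_product_permutation, triple_product_permutation, poynting_cross_right hnull hW,
      dotProduct_neg, dotProduct_comm]
  have horth := dotProduct_along_eq_neg hE hB (fun y => (isNull_iff.1 hnull y).2) V
  have hnorm : E x ⬝ᵥ along V E x = B x ⬝ᵥ along V B x := by
    have hE₂ := dotProduct_along_add hE hE V
    simp only [(isNull_iff.1 hnull _).1, ← dotProduct_along_add hB hB V] at hE₂
    linarith
  have hfirst : V ⬝ᵥ (along (E x) B x + along (B x) E x) =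
      E x ⬝ᵥ curl E x - B x ⬝ᵥ curl B x := by
    rw [dotProduct_add, dotProduct_along, dotProduct_along (B x), hVE, hVB, horth]
    ring
  have hsecond : V ⬝ᵥ (along (E x) E x - along (B x) B x) =
      -(E x ⬝ᵥ curl B x + B x ⬝ᵥ curl E x) := by
    rw [dotProduct_sub, dotProduct_along, dotProduct_along (B x), hVE, hVB, hnorm]
    ring
  rw [rs_dotProduct_curl_eq_zero_iff hE hB, ConformalFoliationAt, hfirst, hsecond, sub_eq_zero,
    neg_eq_zero]

end PointwiseEquivalence

section NullData

variable {F : Fin 3 → ST → ℂ} {E₀ B₀ : Space → Fin 3 → ℝ}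

theorem RealAnalytic.rs (hE₀ : RealAnalytic E₀) (hB₀ : RealAnalytic B₀) :
    RealAnalytic (rs E₀ B₀) := fun x hx =>
  analyticAt_pi_iff.2 fun i =>
    ((Complex.ofRealCLM.analyticAt _).comp (hE₀.apply i x hx)).add
      (analyticAt_const.mul ((Complex.ofRealCLM.analyticAt _).comp (hB₀.apply i x hx)))

theorem div_rs {x : Space} (hE₀ : DifferentiableAt ℝ E₀ x) (hB₀ : DifferentiableAt ℝ B₀ x) :
    div (rs E₀ B₀) x = (div E₀ x : ℝ) + Complex.I * (div B₀ x : ℝ) := by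
  simp only [div, pd_rs hE₀ hB₀, Finset.sum_add_distrib, Finset.mul_sum, Complex.ofReal_sum]

theorem exists_isAnalyticMaxwell (hE₀ : RealAnalytic E₀) (hB₀ : RealAnalytic B₀)
    (hdivE₀ : ∀ x, div E₀ x = 0) (hdivB₀ : ∀ x, div B₀ x = 0) :
    ∃ F, IsAnalyticMaxwell F ∧ electricField F 0 = E₀ ∧ magneticField F 0 = B₀ := by
  have hrs : RealAnalytic (rs E₀ B₀) := hE₀.rs hB₀
  have hdiv : ∀ x, div (rs E₀ B₀) x = 0 := fun x => by
    simp [div_rs (hE₀.differentiable x) (hB₀.differentiable x), hdivE₀, hdivB₀]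
  refine ⟨maxwellEvolution (rs E₀ B₀), isAnalyticMaxwell_maxwellEvolution hrs hdiv,
    funext₂ fun x i => ?_, funext₂ fun x i => ?_⟩
  · simp [electricField, maxwellEvolution_zero_left hrs, NullLight.rs]
  · simp [magneticField, maxwellEvolution_zero_left hrs, NullLight.rs]

theorem IsAnalyticMaxwell.isNull_iff (hF : IsAnalyticMaxwell F) {J : Set ℝ}
    (hJ : Set.Ici 0 ⊆ J) :
    (IsNull (electricField F 0) (magneticField F 0) ∧
        ∀ x, rs (electricField F 0) (magneticField F 0) x ⬝ᵥ
          curl (rs (electricField F 0) (magneticField F 0)) x = 0) ↔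
      ∀ t ∈ J, IsNull (electricField F t) (magneticField F t) := by
  simp only [IsNull, rs_electricField_magneticField,
    curl_slice fun i => (hF.analytic i).differentiable]
  exact hF.complexSquare_eq_zero_on_iff hJ

end NullData

end NullLight

end

theorem mainTheorem2
    (r : WithTop ℕ∞) (hr : 1 ≤ r)
    (J : Set ℝ) (hJ : J = Set.Ici 0 ∨ J = Set.univ)
    (E₀ B₀ : NullLight.Space → Fin 3 → ℝ)
    (hE₀ : AnalyticOnNhd ℝ E₀ Set.univ) (hB₀ : AnalyticOnNhd ℝ B₀ Set.univ)
    (hdivE₀ : ∀ x, NullLight.div E₀ x = 0) (hdivB₀ : ∀ x, NullLight.div B₀ x = 0) :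
    -- every solution with these initial data stays null iff the data satisfy the two conditions
    (∀ E B : ℝ → NullLight.Space → Fin 3 → ℝ,
      NullLight.IsMaxwellSolution r J E B → E 0 = E₀ → B 0 = B₀ →
        ((NullLight.IsNull E₀ B₀ ∧
            ∀ x, NullLight.rs E₀ B₀ x ⬝ᵥ NullLight.curl (NullLight.rs E₀ B₀) x = 0) ↔
          ∀ t ∈ J, NullLight.IsNull (E t) (B t))) ∧
    -- the data give rise to a global null solution iff they satisfy the two conditions
    ((NullLight.IsNull E₀ B₀ ∧
        ∀ x, NullLight.rs E₀ B₀ x ⬝ᵥ NullLight.curl (NullLight.rs E₀ B₀) x = 0) ↔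
      ∃ E B : ℝ → NullLight.Space → Fin 3 → ℝ,
        NullLight.IsMaxwellSolution r J E B ∧ E 0 = E₀ ∧ B 0 = B₀ ∧
          ∀ t ∈ J, NullLight.IsNull (E t) (B t)) ∧
    -- for null data: shear-free iff conformal foliation iff `F · ∇ × F = 0`
    (NullLight.IsNull E₀ B₀ → ∀ x,
      (NullLight.ShearFreeAt E₀ B₀ x ↔ NullLight.ConformalFoliationAt E₀ B₀ x) ∧
      (NullLight.ConformalFoliationAt E₀ B₀ x ↔
        NullLight.rs E₀ B₀ x ⬝ᵥ NullLight.curl (NullLight.rs E₀ B₀) x = 0)) := by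
  obtain ⟨F, hF, rfl, rfl⟩ := NullLight.exists_isAnalyticMaxwell hE₀ hB₀ hdivE₀ hdivB₀
  have hJ_diff : UniqueDiffOn ℝ J := by
    rcases hJ with rfl | rfl
    exacts [uniqueDiffOn_Ici 0, uniqueDiffOn_univ]
  have hJ_sub : Set.Ici 0 ⊆ J := by
    rcases hJ with rfl | rfl
    exacts [subset_rfl, Set.subset_univ _]
  have hsol := hF.isMaxwellSolution r hJ_diff
  have hnull := hF.isNull_iff hJ_sub
  refine ⟨fun E B h hE hB => ?_, ⟨fun h₀ => ⟨_, _, hsol, rfl, rfl, hnull.1 h₀⟩, ?_⟩, ?_⟩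
  · rw [hnull]
    refine forall₂_congr fun t ht => ?_
    obtain ⟨hEt, hBt⟩ := h.unique hJ hr hsol hE hB ht
    rw [hEt, hBt]
  · rintro ⟨E, B, h, hE, hB, hEB⟩
    refine hnull.2 fun t ht => ?_
    obtain ⟨hEt, hBt⟩ := h.unique hJ hr hsol hE hB ht
    exact hEt ▸ hBt ▸ hEB t ht
  · intro h₀ x
    have hE := NullLight.RealAnalytic.differentiable hE₀ x
    have hB := NullLight.RealAnalytic.differentiable hB₀ x
    exact ⟨NullLight.shearFreeAt_iff_conformalFoliationAt hE hB,
      NullLight.conformalFoliationAt_iff_rs_dotProduct_curl_eq_zero hE hB h₀⟩
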